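/- Let $S(\infty)=\bigcup_n S(n)$ be the group of finitely supported permutations of $\mathbb N$. A character of a group $G$ is a function $\phi:G\to\mathbb C$ which is central ($\phi(g_1g_2)=\phi(g_2g_1)$ for all $g_1,g_2\in G$), positive definite (for all $g_1,\dots,g_n\in G$ the matrix $(\phi(g_ig_j^{-1}))_{i,j}$ is Hermitian and non-negative definite), indecomposable (it is not a sum of two linearly independent central positive definite functions) and normalized by $\phi(e)=1$. For a character $\phi$ of $S(\infty)$ and $n\ge 0$ let $$m(n)=\langle\phi|_{S(n)},1\rangle_{S(n)}=\frac1{n!}\sum_{g\in S(n)}\phi(g)$$ be the Fourier coefficient of $\phi|_{S(n)}$ at the trivial character of $S(n)$, that is, at the irreducible character of the one-row Young diagram with $n$ boxes. A sequence of real numbers $(a_n)_{n\ge0}$ is called totally positive if all finite minors of the infinite Toeplitz matrix $(a_{j-i})_{i,j\ge0}$, where $a_k=0$ for $k<0$, are non-negative, and normalized totally positive if moreover $a_0=a_1=1$. Then the map $\phi\mapsto(m(0),m(1),m(2),\dots)$ is a bijection of the set of characters of the group $S(\infty)$ onto the set of normalized totally positive sequences. -/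

import Mathlib

open scoped ComplexOrder

/-- The infinite symmetric group `S(∞) = ⋃ S(n)`: the permutations of `ℕ` that move only finitely
many points. -/
def SInf : Subgroup (Equiv.Perm ℕ) where
  carrier := {σ | {i | σ i ≠ i}.Finite}
  one_mem' := by simp
  mul_mem' := by
    intro σ τ hσ hτ
    refine (Set.Finite.union hσ hτ).subset ?_
    intro i hi
    by_contra h
    simp only [Set.mem_union, Set.mem_ofPred_eq, not_or, not_not] at h
    exact hi (by rw [Equiv.Perm.mul_apply, h.2, h.1])
  inv_mem' := by
    intro σ hσ
    refine Set.Finite.subset hσ ?_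
    intro i hi h
    exact hi (by rw [Equiv.Perm.inv_eq_iff_eq, h])

/-- The inclusion `S(n) → S(∞)`: a permutation of `{0, …, n - 1}` is extended by fixing every
`i ≥ n`. -/
noncomputable def SInf.incl (n : ℕ) : Equiv.Perm (Fin n) →* SInf :=
  (Equiv.Perm.viaEmbeddingHom (Fin.valEmbedding : Fin n ↪ ℕ)).codRestrict SInf (by
    intro g
    refine (Set.finite_lt_nat n).subset ?_
    intro i hi
    by_contra h
    refine hi ?_
    rw [Equiv.Perm.viaEmbeddingHom_apply]
    refine Equiv.Perm.viaEmbedding_apply_of_notMem g _ i ?_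
    rintro ⟨x, rfl⟩
    exact h x.isLt)

/-- A central function on a group. -/
def IsCentralFun {G : Type*} [Group G] (φ : G → ℂ) : Prop :=
  ∀ g₁ g₂ : G, φ (g₁ * g₂) = φ (g₂ * g₁)

/-- A positive definite function on a group: all the matrices `(φ (gᵢ gⱼ⁻¹))` are Hermitian and
non-negative definite. -/
def IsPosDefFun {G : Type*} [Group G] (φ : G → ℂ) : Prop :=
  ∀ (n : ℕ) (g : Fin n → G), (Matrix.of fun i j => φ (g i * (g j)⁻¹)).PosSemidef

/-- A character of a group: a central, positive definite, indecomposable function that is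
normalized by `φ e = 1`. -/
structure IsGroupCharacter {G : Type*} [Group G] (φ : G → ℂ) : Prop where
  central : IsCentralFun φ
  posDef : IsPosDefFun φ
  indecomposable : ∀ φ₁ φ₂ : G → ℂ, IsCentralFun φ₁ → IsPosDefFun φ₁ →
    IsCentralFun φ₂ → IsPosDefFun φ₂ → φ = φ₁ + φ₂ → ¬ LinearIndependent ℂ ![φ₁, φ₂]
  normalized : φ 1 = 1

/-- The Hermitian inner product `⟨f₁, f₂⟩ = (1 / n!) ∑ f₁ g * conj (f₂ g)` of functions
on `S(n)`. -/
noncomputable def permInner (n : ℕ) (f₁ f₂ : Equiv.Perm (Fin n) → ℂ) : ℂ :=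
  ((n.factorial : ℂ))⁻¹ * ∑ g : Equiv.Perm (Fin n), f₁ g * (starRingEnd ℂ) (f₂ g)

/-- The one-row Fourier coefficient `m(n)` of a function on `S(∞)`: the Fourier coefficient of its
restriction to `S(n)` at the irreducible character of the one-row diagram with `n` boxes, that is,
at the trivial character of `S(n)`. -/
noncomputable def oneRowCoeff (φ : SInf → ℂ) (n : ℕ) : ℂ :=
  permInner n (fun g => φ (SInf.incl n g)) (fun _ => 1)

/-- `oneRowCoeff φ n` is the coefficient of the trivial character in every expansion of `φ|S(n)` in
characters of pairwise inequivalent irreducible representations. -/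
theorem oneRowCoeff_eq_of_expansion (φ : SInf → ℂ) (n : ℕ) {ι : Type*} [Fintype ι]
    (V : ι → Type*) [∀ i, AddCommGroup (V i)] [∀ i, Module ℂ (V i)]
    [∀ i, FiniteDimensional ℂ (V i)]
    (ρ : ∀ i, Representation ℂ (Equiv.Perm (Fin n)) (V i)) [∀ i, (ρ i).IsIrreducible]
    (hne : ∀ i j, Nonempty ((ρ i).Equiv (ρ j)) → i = j)
    (m : ι → ℂ) (hφ : ∀ g, φ (SInf.incl n g) = ∑ i, m i * (ρ i).character g)
    (i₀ : ι) (h₀ : ∀ g, (ρ i₀).character g = 1) :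
    oneRowCoeff φ n = m i₀ := by
  classical
  have hcard : ((Nat.card (Equiv.Perm (Fin n)) : ℕ) : ℂ) = (n.factorial : ℂ) := by
    simp [Nat.card_eq_fintype_card, Fintype.card_perm]
  have hn : (n.factorial : ℂ) ≠ 0 := by exact_mod_cast n.factorial_ne_zero
  let _ : Invertible ((Nat.card (Equiv.Perm (Fin n)) : ℕ) : ℂ) :=
    invertibleOfNonzero (by rw [hcard]; exact hn)
  have key : ∀ i, (n.factorial : ℂ)⁻¹ * ∑ g, (ρ i).character g = if i = i₀ then 1 else 0 := by
    intro i
    have h := Representation.char_orthonormal (ρ i) (ρ i₀)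
    simp only [h₀, mul_one, hcard] at h
    rw [h]
    by_cases hi : i = i₀
    · subst hi
      simp [show Nonempty ((ρ i).Equiv (ρ i)) from ⟨Representation.Equiv.refl _⟩]
    · have : ¬ Nonempty ((ρ i₀).Equiv (ρ i)) := fun h => hi (hne _ _ h).symm
      simp [this, hi]
  unfold oneRowCoeff permInner
  simp only [map_one, mul_one, hφ]
  rw [Finset.sum_comm, Finset.mul_sum]
  simp only [← Finset.mul_sum (Finset.univ : Finset (Equiv.Perm (Fin n)))]
  calc ∑ i, (n.factorial : ℂ)⁻¹ * (m i * ∑ g, (ρ i).character g)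
      = ∑ i, m i * (if i = i₀ then 1 else 0) := by
        refine Finset.sum_congr rfl fun i _ => ?_
        rw [← key i]; ring
    _ = m i₀ := by simp

/-- The infinite upper triangular Toeplitz matrix of a sequence. -/
def toeplitz (a : ℕ → ℝ) (i j : ℕ) : ℝ := if i ≤ j then a (j - i) else 0

/-- Totally positive sequences: all the (finite) minors of the Toeplitz matrix are
non-negative. -/
def IsTotallyPositive (a : ℕ → ℝ) : Prop :=
  ∀ (k : ℕ) (r c : Fin k → ℕ), StrictMono r → StrictMono c →
    0 ≤ (Matrix.of fun i j => toeplitz a (r i) (c j)).det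

/-- Normalized totally positive sequences. -/
def IsNormalizedTotallyPositive (a : ℕ → ℝ) : Prop :=
  IsTotallyPositive a ∧ a 0 = 1 ∧ a 1 = 1

/-! A central function on `SInf` depends only on the cycle type, and a normalized positive definite
one is indecomposable exactly when it is multiplicative over disjoint permutations. If `φ` is
indecomposable, multiplying the argument by a disjoint copy of `g` splits it into the positive
definite halves `(φ ± φ(g ·)) / 2`, which must be linearly dependent; this yields multiplicativity.
Conversely, for a decomposition of a multiplicative `φ`, many disjoint copies of `g` give a
nonnegative quadratic for each summand, and these force both summands to be multiples of `φ`.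

Multiplicativity says that the sum of `φ` over a Young subgroup with block sizes `α k` is `∏ (α k)!
* m (α k)`. Sums over Young subgroups determine a central function (induction on the orbit
partition), which gives injectivity. In terms of the Frobenius characteristic `f ↦ ∑ f g • p_g`,
with `p_g` the power sum of the cycle type, the restriction of `φ` to `S(n)` goes to `n!` times the
degree `n` part of `∏_i ∑_k m(k) x_i^k`. After multiplication by the alternant with exponents `r`,
the coefficient at `c` is therefore `n!` times the Toeplitz minor with rows `r` and columns `c`.

Positivity comes from the Jacobi–Trudi characters `schurChar`. A minor is a positive multiple of `∑
χ_r(g) φ(h) χ_c(g ⊕ h)`, the sum of a product of positive definite functions, hence nonnegative by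
the Schur product theorem. Conversely, for a totally positive sequence the minors with rows `0, …, N
- 1` serve as coefficients of a nonnegative combination of the `schurChar`. Its Young subgroup sums
factor, and this alone gives compatibility between different `n`, multiplicativity, and the
prescribed one-row coefficients.

That `schurChar` is positive definite is proved without irreducible representations: it is a
positive multiple of a conjugation-averaged Young symmetrizer, by triangularity in the dominance
order together with the orthogonality of the Jacobi–Trudi characters. -/

set_option linter.unusedSectionVars false

/-! ### Positive definite and central functions. -/

section PosDef

variable {G H : Type*} [Group G] [Group H]

theorem IsPosDefFun.posSemidef {f : G → ℂ} (hf : IsPosDefFun f) {σ : Type*} [Fintype σ]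
    (g : σ → G) : (Matrix.of fun i j => f (g i * (g j)⁻¹)).PosSemidef := by
  have h := (hf (Fintype.card σ) (g ∘ (Fintype.equivFin σ).symm)).submatrix (Fintype.equivFin σ)
  convert h using 1
  ext i j
  simp

theorem isPosDefFun_of_kernel {f : G → ℂ} {T : Type*} [Fintype T] (B : G → T → ℂ)
    (h : ∀ x y, f (x * y⁻¹) = ∑ t, B x t * star (B y t)) : IsPosDefFun f := by
  intro n g
  have := Matrix.posSemidef_self_mul_conjTranspose (Matrix.of fun i t => B (g i) t)
  convert this using 1
  ext i j
  simp [Matrix.mul_apply, h]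

/-- Conjugation by the group algebra element `∑ b s • a s`: the matrix is `B * M * Bᴴ`, where `M` is
the matrix of `f` at all the products `a s * θ (g i)`. -/
theorem IsPosDefFun.sandwich {f : G → ℂ} (hf : IsPosDefFun f) (θ : H →* G)
    {σ : Type*} [Fintype σ] (a : σ → G) (b : σ → ℂ) :
    IsPosDefFun fun h => ∑ s, ∑ t, b s * f (a s * θ h * (a t)⁻¹) * star (b t) := by
  classical
  intro n g
  have h := (hf.posSemidef fun p : Fin n × σ => a p.2 * θ (g p.1)).mul_mul_conjTranspose_same
    (Matrix.of fun (i : Fin n) (p : Fin n × σ) => if i = p.1 then b p.2 else 0)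
  convert h using 1
  ext i j
  simp only [Matrix.of_apply, Matrix.mul_apply, Matrix.conjTranspose_apply,
    Fintype.sum_prod_type, ite_mul, zero_mul, apply_ite star, star_zero, mul_ite, mul_zero]
  simp only [Finset.sum_mul, ite_mul, zero_mul]
  rw [Finset.sum_eq_single j]
  · simp only [if_true]
    rw [Finset.sum_comm]
    refine Finset.sum_congr rfl fun s _ => ?_
    rw [Finset.sum_eq_single i]
    · simp [mul_assoc]
    · intro k _ hk
      simp [Ne.symm hk]
    · simp
  · intro k _ hk
    simp [Ne.symm hk]
  · simp

theorem IsPosDefFun.comp_hom {f : G → ℂ} (hf : IsPosDefFun f) (θ : H →* G) :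
    IsPosDefFun fun h => f (θ h) := by
  intro n g
  convert hf n (θ ∘ g) using 3
  simp

theorem IsPosDefFun.one_nonneg {f : G → ℂ} (hf : IsPosDefFun f) : 0 ≤ f 1 := by
  simpa using (hf 1 fun _ => 1).diag_nonneg (i := 0)

theorem IsPosDefFun.quadratic_nonneg {f : G → ℂ} (hf : IsPosDefFun f) {σ : Type*} [Fintype σ]
    (a : σ → G) (b : σ → ℂ) : 0 ≤ ∑ s, ∑ t, b s * f (a s * (a t)⁻¹) * star (b t) := by
  simpa using (hf.sandwich (MonoidHom.id G) a b).one_nonneg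

theorem IsPosDefFun.map_inv {f : G → ℂ} (hf : IsPosDefFun f) (g : G) : f g⁻¹ = star (f g) := by
  have := (hf 2 ![1, g]).1.apply 0 1
  simpa using this.symm

theorem IsPosDefFun.mul {f₁ f₂ : G → ℂ} (h₁ : IsPosDefFun f₁) (h₂ : IsPosDefFun f₂) :
    IsPosDefFun fun g => f₁ g * f₂ g := fun n g => (h₁ n g).hadamard (h₂ n g)

theorem IsPosDefFun.sum {σ : Type*} {s : Finset σ} {f : σ → G → ℂ}
    (h : ∀ i ∈ s, IsPosDefFun (f i)) : IsPosDefFun fun g => ∑ i ∈ s, f i g := by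
  intro n g
  convert Matrix.posSemidef_sum s (fun i hi => h i hi n g) using 1
  ext i j
  simp [Matrix.sum_apply]

theorem IsPosDefFun.const_mul {f : G → ℂ} (h : IsPosDefFun f) {a : ℂ} (ha : 0 ≤ a) :
    IsPosDefFun fun g => a * f g := by
  intro n g
  convert (h n g).smul ha using 1
  ext i j
  simp

/-- The quadratic form at the all-ones vector is the order of `G` times this sum. Applied to
products of positive definite functions, it is the source of every nonnegativity below. -/
theorem IsPosDefFun.sum_nonneg [Fintype G] {f : G → ℂ} (hf : IsPosDefFun f) :
    0 ≤ ∑ g, f g := by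
  have h := hf.quadratic_nonneg (σ := G) id (fun _ => 1)
  simp only [id, one_mul, star_one, mul_one] at h
  rw [Finset.sum_comm] at h
  have h2 : ∀ t : G, ∑ s, f (s * t⁻¹) = ∑ s, f s := fun t =>
    Fintype.sum_equiv (Equiv.mulRight t⁻¹) _ _ fun _ => rfl
  simp only [h2, Finset.sum_const, nsmul_eq_mul] at h
  have hc : (0 : ℂ) < (Finset.univ : Finset G).card := by
    exact_mod_cast Finset.card_pos.2 ⟨1, Finset.mem_univ _⟩
  have h3 := mul_nonneg (inv_nonneg.2 hc.le) h
  rwa [inv_mul_cancel_left₀ hc.ne'] at h3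

theorem IsCentralFun.conj {f : G → ℂ} (hf : IsCentralFun f) (g h : G) : f (h * g * h⁻¹) = f g := by
  rw [hf]; simp

theorem IsCentralFun.eq_of_isConj {f : G → ℂ} (hf : IsCentralFun f) {g h : G} (hc : IsConj g h) :
    f g = f h := by
  obtain ⟨c, rfl⟩ := isConj_iff.1 hc
  exact (hf.conj g c).symm

theorem isCentralFun_of_conj {f : G → ℂ} (hf : ∀ g h, f (h * g * h⁻¹) = f g) :
    IsCentralFun f := by
  intro g h
  have := hf (g * h) g⁻¹
  rw [← this]; simp

end PosDef

/-! ### Cycle types of composed permutations. -/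

section CycleType

open Equiv

variable {ι κ : Type*} [Fintype ι] [DecidableEq ι] [Fintype κ] [DecidableEq κ]

theorem cycleType_of_intertwine (e : ι → κ) (he : Function.Injective e) (g : Perm ι) (h : Perm κ)
    (h1 : ∀ i, h (e i) = e (g i)) (h2 : ∀ k, k ∉ Set.range e → h k = k) :
    h.cycleType = g.cycleType := by
  classical
  have : h = g.extendDomain (Equiv.ofInjective e he) := by
    ext k
    by_cases hk : k ∈ Set.range e
    · obtain ⟨i, rfl⟩ := hk
      have := Perm.extendDomain_apply_image g (Equiv.ofInjective e he) i
      simp only [Equiv.ofInjective_apply] at this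
      rw [this, h1]
    · rw [h2 k hk, Perm.extendDomain_apply_not_subtype _ _ hk]
  rw [this, Perm.cycleType_extendDomain]

theorem cycleType_permCongr (e : ι ≃ κ) (g : Perm ι) :
    (e.permCongr g).cycleType = g.cycleType :=
  cycleType_of_intertwine e e.injective g _ (by simp [Equiv.permCongr_apply])
    fun k hk => (hk (e.surjective k)).elim

theorem cycleType_sumCongr (g : Perm ι) (h : Perm κ) :
    (Perm.sumCongr g h).cycleType = g.cycleType + h.cycleType := by
  have h1 : Perm.sumCongr g h = Perm.sumCongr g 1 * Perm.sumCongr 1 h := by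
    rw [Perm.sumCongr_mul]; simp
  have hd : Perm.Disjoint (Perm.sumCongr g (1 : Perm κ)) (Perm.sumCongr (1 : Perm ι) h) := by
    rintro (i | k)
    · right; simp
    · left; simp
  rw [h1, hd.cycleType_mul]
  congr 1
  · refine cycleType_of_intertwine Sum.inl Sum.inl_injective _ _ (by simp) ?_
    rintro (i | k) hk
    · exact (hk ⟨i, rfl⟩).elim
    · simp
  · refine cycleType_of_intertwine Sum.inr Sum.inr_injective _ _ (by simp) ?_
    rintro (i | k) hk
    · simp
    · exact (hk ⟨k, rfl⟩).elim

theorem cycleType_sigmaCongrRight {β : ι → Type*} [∀ i, Fintype (β i)] [∀ i, DecidableEq (β i)]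
    (F : ∀ i, Perm (β i)) :
    (Perm.sigmaCongrRight F).cycleType = ∑ i, (F i).cycleType := by
  have key : ∀ (s : Finset ι) (F : ∀ i, Perm (β i)), (∀ i, i ∉ s → F i = 1) →
      (Perm.sigmaCongrRight F).cycleType = ∑ i ∈ s, (F i).cycleType := by
    intro s
    induction s using Finset.induction_on with
    | empty =>
      intro F hF
      have : F = 1 := funext fun i => hF i (Finset.notMem_empty i)
      rw [this, Perm.sigmaCongrRight_one]; simp
    | insert a s ha ih =>
      intro F hF
      have h1 : F = Pi.mulSingle a (F a) * Function.update F a 1 := by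
        funext i
        by_cases hi : i = a
        · subst hi; simp
        · simp [hi]
      have hd : Perm.Disjoint (Perm.sigmaCongrRight (Pi.mulSingle a (F a)))
          (Perm.sigmaCongrRight (Function.update F a 1)) := by
        rintro ⟨i, b⟩
        by_cases hi : i = a
        · subst hi; right; simp
        · left; simp [hi]
      have h2 : (Perm.sigmaCongrRight (Pi.mulSingle a (F a))).cycleType = (F a).cycleType := by
        refine cycleType_of_intertwine (Sigma.mk a) sigma_mk_injective _ _ (by simp) ?_
        rintro ⟨i, b⟩ hk
        have hi : i ≠ a := by rintro rfl; exact hk ⟨b, rfl⟩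
        simp [hi]
      have h3 := ih (Function.update F a 1) (by
        intro i hi
        by_cases h : i = a
        · subst h; simp
        · simpa [h] using hF i (by simp [h, hi]))
      rw [Finset.sum_insert ha]
      conv_lhs => rw [h1]
      rw [← Perm.sigmaCongrRight_mul, hd.cycleType_mul, h2, h3]
      congr 1
      refine Finset.sum_congr rfl fun i hi => ?_
      have : i ≠ a := by rintro rfl; exact ha hi
      simp [this]
  exact key Finset.univ F (by simp)

/-- The cycle type is the multiset of the sizes of the nontrivial orbits, so only the orbit
partition matters. -/
theorem cycleType_eq_of_sameCycle_iff {g h : Perm ι} (H : ∀ x y, g.SameCycle x y ↔ h.SameCycle x y) :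
    g.cycleType = h.cycleType := by
  have hsupp : g.support = h.support := by
    have : ∀ g : Perm ι, ∀ x, x ∈ g.support ↔ ∃ y, y ≠ x ∧ g.SameCycle x y := by
      intro g x
      rw [Perm.mem_support]
      constructor
      · intro hx; exact ⟨g x, hx, ⟨1, by simp⟩⟩
      · rintro ⟨y, hy, k, hk⟩ hx
        exact hy (by rw [← hk, Perm.zpow_apply_eq_self_of_apply_eq_self hx])
    ext x
    rw [this, this]
    simp only [H]
  have key : ∀ g : Perm ι, g.cycleType =
      ((g.support.image fun x => Finset.univ.filter fun y => g.SameCycle x y).val.map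
        Finset.card) := by
    intro g
    have h1 : (g.cycleFactorsFinset.image Perm.support) =
        g.support.image fun x => Finset.univ.filter fun y => g.SameCycle x y := by
      ext s
      simp only [Finset.mem_image]
      constructor
      · rintro ⟨c, hc, rfl⟩
        obtain ⟨x, hx⟩ := (Perm.mem_cycleFactorsFinset_iff.1 hc).1.nonempty_support
        refine ⟨x, Perm.mem_cycleFactorsFinset_support_le hc hx, ?_⟩
        rw [Perm.cycle_is_cycleOf hx hc]
        ext y
        rw [Perm.mem_support_cycleOf_iff, Finset.mem_filter]
        simp [-Perm.mem_support, Perm.mem_cycleFactorsFinset_support_le hc hx]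
      · rintro ⟨x, hx, rfl⟩
        refine ⟨g.cycleOf x, Perm.cycleOf_mem_cycleFactorsFinset_iff.2 hx, ?_⟩
        ext y
        rw [Perm.mem_support_cycleOf_iff, Finset.mem_filter]
        simp [-Perm.mem_support, hx]
    rw [Perm.cycleType_def, ← h1, Finset.image_val_of_injOn, Multiset.map_map]
    intro c hc d hd hcd
    obtain ⟨x, hx⟩ := (Perm.mem_cycleFactorsFinset_iff.1 hc).1.nonempty_support
    rw [Perm.cycle_is_cycleOf hx hc, Perm.cycle_is_cycleOf (hcd ▸ hx) hd]
  rw [key g, key h, hsupp]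
  simp only [H]

end CycleType

/-! ### Sums over Young subgroups. -/

section Stabilizer

open Equiv

variable {ι κ : Type*} [Fintype ι] [DecidableEq ι] [DecidableEq κ]

/-- The sum of a function over the permutations that preserve the word `w`, that is, over the
Young subgroup of `w`. -/
noncomputable def stabSum (f : Perm ι → ℂ) (w : ι → κ) : ℂ :=
  ∑ g : Perm ι with ∀ i, w (g i) = w i, f g

theorem stabSum_comp_injective {κ' : Type*} [DecidableEq κ'] (f : Perm ι → ℂ) (w : ι → κ)
    (e : κ → κ') (he : Function.Injective e) : stabSum f (e ∘ w) = stabSum f w := by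
  unfold stabSum
  congr 1
  ext g
  simp only [Finset.mem_filter, Finset.mem_univ, true_and]
  exact forall_congr' fun i => he.eq_iff

theorem stabSum_comp_perm {f : Perm ι → ℂ} (hf : IsCentralFun f) (w : ι → κ) (h : Perm ι) :
    stabSum f (w ∘ h) = stabSum f w := by
  unfold stabSum
  refine Finset.sum_bij' (fun g _ => h * g * h⁻¹) (fun g _ => h⁻¹ * g * h) ?_ ?_ ?_ ?_ ?_
  · intro g hg
    simp only [Finset.mem_filter, Finset.mem_univ, true_and] at hg ⊢
    intro i
    simpa using hg (h⁻¹ i)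
  · intro g hg
    simp only [Finset.mem_filter, Finset.mem_univ, true_and] at hg ⊢
    intro i
    simpa using hg (h i)
  · intro g _; group
  · intro g _; group
  · intro g _; rw [hf.conj]

/-- A central function is determined by its sums over the Young subgroups. -/
theorem IsCentralFun.eq_zero_of_stabSum {f : Perm ι → ℂ} (hf : IsCentralFun f)
    (h : ∀ w : ι → ι, stabSum f w = 0) : f = 0 := by
  have : Finite (Setoid ι) := Finite.of_injective (fun s : Setoid ι => s.r) fun s t hst =>
    Setoid.ext fun a b => iff_of_eq (congrFun (congrFun hst a) b)
  have : WellFoundedLT (Setoid ι) := Finite.to_wellFoundedLT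
  -- Induction on the orbit partition, finer partitions being smaller. Let `w` have the orbits of
  -- `g` as fibres. A permutation preserving `w` has a finer orbit partition: if strictly finer, `f`
  -- vanishes there by induction; if equal, it is conjugate to `g`. So the Young subgroup sum is a
  -- positive multiple of `f g`.
  have key : ∀ (s : Setoid ι) (g : Perm ι), Perm.SameCycle.setoid g = s → f g = 0 := by
    intro s
    induction s using WellFoundedLT.induction with
    | ind s ih =>
      intro g hg
      classical
      let w : ι → ι := fun i => (Quotient.mk s i).out
      have hw : ∀ i j, w i = w j ↔ g.SameCycle i j := by
        intro i j
        have : s i j ↔ g.SameCycle i j := by rw [← hg]; rfl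
        rw [← this]
        simp only [w, Quotient.out_inj]
        exact Quotient.eq
      have h0 := h w
      unfold stabSum at h0
      have h1 : ∀ k ∈ Finset.univ.filter (fun k : Perm ι => ∀ i, w (k i) = w i),
          f k = if k.cycleType = g.cycleType then
            (if ∀ x y, k.SameCycle x y ↔ g.SameCycle x y then f g else 0) else 0 := by
        intro k hk
        simp only [Finset.mem_filter, Finset.mem_univ, true_and] at hk
        have hle : ∀ x y, k.SameCycle x y → g.SameCycle x y := by
          have hn : ∀ (n : ℕ) x, w ((k ^ n) x) = w x := by
            intro n
            induction n with
            | zero => simp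
            | succ n ihn => intro x; rw [pow_succ', Perm.mul_apply, hk, ihn]
          intro x y hxy
          obtain ⟨n, hn'⟩ := hxy.exists_nat_pow_eq
          rw [← hw, ← hn', hn]
        by_cases he : ∀ x y, k.SameCycle x y ↔ g.SameCycle x y
        · have hc := cycleType_eq_of_sameCycle_iff he
          rw [if_pos hc, if_pos he]
          exact hf.eq_of_isConj (Perm.isConj_iff_cycleType_eq.2 hc)
        · rw [if_neg he, ite_self]
          refine ih (Perm.SameCycle.setoid k) ?_ k rfl
          rw [← hg]
          refine lt_of_le_of_ne (fun {x y} => hle x y) ?_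
          intro heq
          apply he
          intro x y
          exact Setoid.ext_iff.1 heq x y
      rw [Finset.sum_congr rfl h1] at h0
      simp only [← Finset.sum_filter, Finset.sum_const, smul_eq_zero,
        Finset.filter_filter] at h0
      rcases h0 with h0 | h0
      · rw [Finset.card_eq_zero] at h0
        have : g ∈ (∅ : Finset (Perm ι)) := by
          rw [← h0]
          simp only [Finset.mem_filter, Finset.mem_univ, true_and, and_true, iff_self,
            implies_true]
          intro i
          exact (hw _ _).2 (Perm.sameCycle_apply_left.2 (Perm.SameCycle.refl g i))
        simp at this
      · exact h0
  funext g
  exact key _ g rfl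

/-- The Young subgroup of a word is the product of the symmetric groups of its fibres. -/
theorem stabSum_eq_sum_pi [Fintype κ] (f : Perm ι → ℂ) (w : ι → κ) :
    stabSum f w = ∑ F : ∀ k, Perm {i // w i = k},
      f ((sigmaFiberEquiv w).permCongr (Perm.sigmaCongrRight F)) := by
  unfold stabSum
  symm
  refine Finset.sum_bij (fun F _ => (sigmaFiberEquiv w).permCongr (Perm.sigmaCongrRight F))
    ?_ ?_ ?_ ?_
  · intro F _
    simp only [Finset.mem_filter, Finset.mem_univ, true_and]
    intro i
    simp only [permCongr_apply, sigmaFiberEquiv, coe_fn_symm_mk,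
      Perm.sigmaCongrRight, sigmaCongrRight_apply, coe_fn_mk]
    exact (F (w i) ⟨i, rfl⟩).2
  · intro F _ F' _ hFF
    exact Perm.sigmaCongrRightHom_injective ((Equiv.permCongr _).injective hFF)
  · intro g hg
    simp only [Finset.mem_filter, Finset.mem_univ, true_and] at hg
    refine ⟨fun k => g.subtypePerm fun i => by rw [hg], Finset.mem_univ _, ?_⟩
    ext i
    simp [permCongr_apply, sigmaFiberEquiv, Perm.sigmaCongrRight]
  · intros; rfl

theorem stabSum_one [Fintype κ] (w : ι → κ) :
    stabSum (fun _ => 1) w = ∏ k, ((Fintype.card {i // w i = k}).factorial : ℂ) := by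
  rw [stabSum_eq_sum_pi]
  simp [Fintype.card_pi, Fintype.card_perm]

/-- Sums over Young subgroups of a multiplicative function of the cycle type factor. -/
theorem stabSum_multiplicative [Fintype κ] (Φ : Multiset ℕ → ℂ) (h0 : Φ 0 = 1)
    (hΦ : ∀ (m n : ℕ) (g : Perm (Fin m)) (h : Perm (Fin n)),
      Φ (g.cycleType + h.cycleType) = Φ g.cycleType * Φ h.cycleType) (w : ι → κ) :
    stabSum (fun g => Φ g.cycleType) w =
      ∏ k, ∑ g : Perm (Fin (Fintype.card {i // w i = k})), Φ g.cycleType := by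
  have hcard : ∀ k, ∑ g : Perm (Fin (Fintype.card {i // w i = k})), Φ g.cycleType =
      ∑ g : Perm {i // w i = k}, Φ g.cycleType := fun k =>
    Fintype.sum_equiv (Fintype.equivFin _).symm.permCongr _ _ fun g => by
      rw [cycleType_permCongr]
  simp only [hcard]
  have hΦ' : ∀ {α β : Type _} [Fintype α] [DecidableEq α] [Fintype β] [DecidableEq β]
      (g : Perm α) (h : Perm β),
      Φ (g.cycleType + h.cycleType) = Φ g.cycleType * Φ h.cycleType := by
    intro α β _ _ _ _ g h
    have := hΦ _ _ ((Fintype.equivFin α).permCongr g) ((Fintype.equivFin β).permCongr h)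
    simpa only [cycleType_permCongr] using this
  rw [stabSum_eq_sum_pi, Fintype.prod_sum]
  refine Finset.sum_congr rfl fun F _ => ?_
  rw [cycleType_permCongr, cycleType_sigmaCongrRight]
  -- The second conjunct is needed because multiplicativity is assumed only on multisets that are
  -- cycle types.
  have key : ∀ s : Finset κ, Φ (∑ k ∈ s, (F k).cycleType) = ∏ k ∈ s, Φ (F k).cycleType ∧
      ∃ G : Perm ι, G.cycleType = ∑ k ∈ s, (F k).cycleType := by
    intro s
    induction s using Finset.induction_on with
    | empty => exact ⟨by simpa using h0, 1, by simp⟩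
    | insert a s ha ih =>
      obtain ⟨ih1, G, hG⟩ := ih
      constructor
      · rw [Finset.sum_insert ha, Finset.prod_insert ha, ← ih1, ← hG, hΦ']
      · refine ⟨(sigmaFiberEquiv w).permCongr (Perm.sigmaCongrRight fun k =>
          if k ∈ insert a s then F k else 1), ?_⟩
        rw [cycleType_permCongr, cycleType_sigmaCongrRight]
        rw [← Finset.sum_subset (Finset.subset_univ (insert a s))]
        · exact Finset.sum_congr rfl fun k hk => by rw [if_pos hk]
        · intro k _ hk
          rw [if_neg hk]; simp
  exact (key Finset.univ).1

end Stabilizer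

/-! ### Words, contents and orbit counting. -/

section Words

open Equiv

variable {ι κ : Type*} [Fintype ι] [DecidableEq ι] [Fintype κ] [DecidableEq κ]

/-- The content of a word: how often each letter occurs. -/
def wordContent (w : ι → κ) (k : κ) : ℕ := Fintype.card {i // w i = k}

theorem wordContent_eq_card (w : ι → κ) (k : κ) :
    wordContent w k = (Finset.univ.filter fun i => w i = k).card := Fintype.card_subtype _

theorem sum_wordContent (w : ι → κ) : ∑ k, wordContent w k = Fintype.card ι := by
  unfold wordContent
  rw [← Fintype.card_sigma]
  exact Fintype.card_congr (sigmaFiberEquiv w)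

theorem wordContent_comp_perm (w : ι → κ) (g : Perm ι) : wordContent (w ∘ g) = wordContent w := by
  funext k
  exact Fintype.card_congr (g.subtypeEquiv fun i => Iff.rfl)

theorem exists_perm_of_wordContent_eq {z w : ι → κ} (h : wordContent z = wordContent w) :
    ∃ g : Perm ι, w ∘ g = z := by
  have e : ∀ k, {i // z i = k} ≃ {i // w i = k} := fun k =>
    Fintype.equivOfCardEq (congrFun h k)
  exact ⟨Equiv.ofFiberEquiv e, funext fun i => Equiv.ofFiberEquiv_map e i⟩

theorem exists_word_of_sum_eq (γ : κ → ℕ) (h : ∑ k, γ k = Fintype.card ι) :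
    ∃ w : ι → κ, wordContent w = γ := by
  have e : ι ≃ Σ k, Fin (γ k) := Fintype.equivOfCardEq (by simp [h])
  refine ⟨fun i => (e i).1, funext fun k => ?_⟩
  have : {i // (e i).1 = k} ≃ Fin (γ k) :=
    (e.subtypeEquiv (fun i => Iff.rfl) : {i // (e i).1 = k} ≃ {x : Σ k, Fin (γ k) // x.1 = k}).trans
      (Equiv.sigmaSubtype k)
  unfold wordContent
  rw [Fintype.card_congr this, Fintype.card_fin]

/-- Summing over the words of given content the sums of a central function over their Young
subgroups. -/
theorem sum_stabSum_of_wordContent {f : Perm ι → ℂ} (hf : IsCentralFun f) (w : ι → κ) :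
    ∑ z with wordContent z = wordContent w, stabSum f z =
      ((Finset.univ.filter fun z : ι → κ => wordContent z = wordContent w).card : ℂ) *
        stabSum f w := by
  rw [← nsmul_eq_mul, ← Finset.sum_const]
  refine Finset.sum_congr rfl fun z hz => ?_
  obtain ⟨g, rfl⟩ := exists_perm_of_wordContent_eq (Finset.mem_filter.1 hz).2
  exact stabSum_comp_perm hf w g

/-- Orbit–stabilizer: the words of a given content form one orbit, and the permutations carrying `w`
to `z` form a coset of the stabilizer of `z`. -/
theorem sum_card_stab (w : ι → κ) :
    ∑ z with wordContent z = wordContent w,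
      (Finset.univ.filter fun g : Perm ι => ∀ i, z (g i) = z i).card =
        (Fintype.card ι).factorial := by
  rw [← Fintype.card_perm, ← Finset.card_univ]
  rw [Finset.card_eq_sum_card_fiberwise (f := fun g : Perm ι => w ∘ g)
    (t := Finset.univ.filter fun z : ι → κ => wordContent z = wordContent w)]
  · refine Finset.sum_congr rfl fun z hz => ?_
    obtain ⟨h, rfl⟩ := exists_perm_of_wordContent_eq (Finset.mem_filter.1 hz).2
    refine Finset.card_bij' (fun g _ => h * g) (fun g _ => h⁻¹ * g) ?_ ?_ ?_ ?_
    · intro g hg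
      simp only [Finset.mem_filter, Finset.mem_univ, true_and] at hg ⊢
      exact funext hg
    · intro g hg
      simp only [Finset.mem_filter, Finset.mem_univ, true_and] at hg ⊢
      intro i
      simpa using congrFun hg i
    · intro g _; simp
    · intro g _; simp
  · intro g _
    simp [wordContent_comp_perm]

theorem card_words_mul_prod_factorial (w : ι → κ) :
    ((Finset.univ.filter fun z : ι → κ => wordContent z = wordContent w).card : ℂ) *
      ∏ k, ((wordContent w k).factorial : ℂ) = ((Fintype.card ι).factorial : ℂ) := by
  have h := sum_stabSum_of_wordContent (ι := ι) (f := fun _ => 1) (fun _ _ => rfl) w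
  rw [stabSum_one] at h
  refine h.symm.trans ?_
  rw [← sum_card_stab w]
  push_cast
  refine Finset.sum_congr rfl fun z _ => ?_
  simp [stabSum]

/-- Counting orbits: permutations together with the words that they preserve. -/
theorem sum_sum_fixed_words {M : Type*} [AddCommMonoid M] (F : (κ → ℕ) → M) :
    ∑ g : Perm ι, ∑ z : ι → κ with ∀ i, z (g i) = z i, F (wordContent z) =
      (Fintype.card ι).factorial •
        ∑ γ ∈ Finset.piAntidiag Finset.univ (Fintype.card ι), F γ := by
  simp only [Finset.sum_filter]
  rw [Finset.sum_comm]
  simp only [← Finset.sum_filter, Finset.sum_const]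
  -- Each word is counted with the order of its stabilizer, so each content class contributes the
  -- order of the full symmetric group.
  rw [← Finset.sum_fiberwise_of_maps_to (g := fun z : ι → κ => wordContent z)
    (t := Finset.piAntidiag Finset.univ (Fintype.card ι))]
  · rw [Finset.smul_sum]
    refine Finset.sum_congr rfl fun γ hγ => ?_
    obtain ⟨w, rfl⟩ := exists_word_of_sum_eq (ι := ι) γ (Finset.mem_piAntidiag.1 hγ).1
    rw [← sum_card_stab w, Finset.sum_smul]
    refine Finset.sum_congr rfl fun z hz => ?_
    rw [(Finset.mem_filter.1 hz).2]
  · intro z _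
    simp [Finset.mem_piAntidiag, sum_wordContent]

end Words

/-! ### Power sums, the Frobenius characteristic and the Cauchy identity. -/

section Polynomials

open Equiv MvPolynomial

variable {ι κ : Type*} [Fintype ι] [DecidableEq ι] [Fintype κ] [DecidableEq κ]

/-- The monomial with the given exponents. -/
noncomputable def mono (α : κ → ℕ) : MvPolynomial κ ℂ :=
  monomial (Finsupp.equivFunOnFinite.symm α) 1

/-- The coefficient at given exponents. -/
noncomputable def coeffAt (α : κ → ℕ) (P : MvPolynomial κ ℂ) : ℂ :=
  coeff (Finsupp.equivFunOnFinite.symm α) P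

theorem coeffAt_mono (α β : κ → ℕ) : coeffAt α (mono β) = if β = α then 1 else 0 := by
  simp [coeffAt, mono, coeff_monomial]

theorem mono_add (α β : κ → ℕ) : mono (α + β) = mono α * mono β := by
  unfold mono
  rw [monomial_mul, one_mul]
  exact congrArg (fun m => monomial m (1 : ℂ)) (by ext; simp)

theorem mono_zero : mono (0 : κ → ℕ) = 1 := by
  have : Finsupp.equivFunOnFinite.symm (0 : κ → ℕ) = 0 := by ext; simp
  simp [mono, this]

theorem mono_sum {σ : Type*} (s : Finset σ) (B : σ → κ → ℕ) :
    mono (∑ k ∈ s, B k) = ∏ k ∈ s, mono (B k) := by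
  classical
  induction s using Finset.induction_on with
  | empty => simp [mono_zero]
  | insert a s ha ih => rw [Finset.sum_insert ha, Finset.prod_insert ha, mono_add, ih]

theorem mono_eq_prod (α : κ → ℕ) : mono α = ∏ k, X k ^ α k := by
  simp [mono, monomial_eq, Finsupp.prod_fintype]

theorem coeffAt_sub (α : κ → ℕ) (P Q : MvPolynomial κ ℂ) :
    coeffAt α (P - Q) = coeffAt α P - coeffAt α Q := coeff_sub _ _ _ _

theorem coeffAt_sum {σ : Type*} (α : κ → ℕ) (s : Finset σ) (P : σ → MvPolynomial κ ℂ) :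
    coeffAt α (∑ i ∈ s, P i) = ∑ i ∈ s, coeffAt α (P i) := coeff_sum _ _ _

theorem coeffAt_smul (α : κ → ℕ) (a : ℂ) (P : MvPolynomial κ ℂ) :
    coeffAt α (a • P) = a * coeffAt α P := coeff_smul _ _ _

theorem coeffAt_ext {P Q : MvPolynomial κ ℂ} (h : ∀ α, coeffAt α P = coeffAt α Q) : P = Q := by
  ext m
  have := h m
  simpa [coeffAt] using this

theorem coeffAt_mono_mul (α β : κ → ℕ) (P : MvPolynomial κ ℂ) :
    coeffAt α (mono β * P) = if ∀ k, β k ≤ α k then coeffAt (α - β) P else 0 := by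
  unfold coeffAt mono
  rw [coeff_monomial_mul']
  have h1 : (Finsupp.equivFunOnFinite.symm β ≤ Finsupp.equivFunOnFinite.symm α) ↔ ∀ k, β k ≤ α k := by
    simp [Finsupp.le_def]
  have h2 : Finsupp.equivFunOnFinite.symm α - Finsupp.equivFunOnFinite.symm β =
      Finsupp.equivFunOnFinite.symm (α - β) := by ext; simp
  simp only [h1, h2, one_mul]

/-- The sum of the monomials of the words that are preserved by a permutation. It is the power sum
symmetric function of the cycle type. -/
noncomputable def fixedWords (κ : Type*) [Fintype κ] [DecidableEq κ] (g : Perm ι) :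
    MvPolynomial κ ℂ :=
  ∑ w : ι → κ with ∀ i, w (g i) = w i, mono (wordContent w)

theorem coeffAt_fixedWords (α : κ → ℕ) (g : Perm ι) :
    coeffAt α (fixedWords κ g) =
      ∑ w : ι → κ with wordContent w = α, if ∀ i, w (g i) = w i then 1 else 0 := by
  unfold fixedWords
  rw [coeffAt_sum]
  simp only [coeffAt_mono, Finset.sum_filter]
  refine Finset.sum_congr rfl fun w _ => ?_
  split_ifs <;> rfl

/-- The complete homogeneous symmetric polynomial. -/
noncomputable def complete (κ : Type*) [Fintype κ] [DecidableEq κ] (d : ℕ) : MvPolynomial κ ℂ :=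
  ∑ β ∈ Finset.piAntidiag Finset.univ d, mono β

/-- The coefficient sums `f g` over pairs of a word of this content and a permutation preserving it;
by centrality all these words have the same Young subgroup sum. Thus the Frobenius characteristic
encodes exactly the Young subgroup sums. -/
theorem coeffAt_sum_smul_fixedWords {f : Perm ι → ℂ} (hf : IsCentralFun f) (w : ι → κ) :
    coeffAt (wordContent w) (∑ g, f g • fixedWords κ g) =
      ((Finset.univ.filter fun z : ι → κ => wordContent z = wordContent w).card : ℂ) *
        stabSum f w := by
  rw [← sum_stabSum_of_wordContent hf, coeffAt_sum]
  simp only [coeffAt_smul, coeffAt_fixedWords, stabSum, Finset.mul_sum, mul_ite, mul_one, mul_zero]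
  rw [Finset.sum_comm]
  simp only [Finset.sum_filter]

theorem coeffAt_fixedWords_eq_zero {α : κ → ℕ} (h : ∑ k, α k ≠ Fintype.card ι) (g : Perm ι) :
    coeffAt α (fixedWords κ g) = 0 := by
  rw [coeffAt_fixedWords]
  refine Finset.sum_eq_zero fun w hw => ?_
  refine (h ?_).elim
  rw [← (Finset.mem_filter.1 hw).2, sum_wordContent]

theorem wordContent_fst {κ' : Type*} [Fintype κ'] [DecidableEq κ'] (z : ι → κ × κ') (k : κ) :
    wordContent (fun i => (z i).1) k = ∑ l, wordContent z (k, l) := by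
  simp only [wordContent_eq_card]
  rw [Finset.card_eq_sum_card_fiberwise (f := fun i => (z i).2) (t := Finset.univ)
    (fun _ _ => Finset.mem_coe.2 (Finset.mem_univ _))]
  refine Finset.sum_congr rfl fun l _ => ?_
  congr 1
  ext i
  simp [Prod.ext_iff]

theorem wordContent_snd {κ' : Type*} [Fintype κ'] [DecidableEq κ'] (z : ι → κ × κ') (l : κ') :
    wordContent (fun i => (z i).2) l = ∑ k, wordContent z (k, l) := by
  simp only [wordContent_eq_card]
  rw [Finset.card_eq_sum_card_fiberwise (f := fun i => (z i).1) (t := Finset.univ)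
    (fun _ _ => Finset.mem_coe.2 (Finset.mem_univ _))]
  refine Finset.sum_congr rfl fun k _ => ?_
  congr 1
  ext i
  simp [Prod.ext_iff, and_comm]

/-- The Cauchy identity: permutation characters of Young subgroups correspond to products of
complete homogeneous symmetric polynomials. -/
theorem sum_coeffAt_smul_fixedWords {α : κ → ℕ} (h : ∑ k, α k = Fintype.card ι) :
    ∑ g : Perm ι, coeffAt α (fixedWords κ g) • fixedWords κ g =
      (Fintype.card ι).factorial • ∏ k, complete κ (α k) := by
  -- A pair of words preserved by `g` is one preserved word in the alphabet `κ × κ`. Its content is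
  -- a matrix whose row and column sums are the contents of the two words.
  have h1 : ∀ g : Perm ι, coeffAt α (fixedWords κ g) • fixedWords κ g =
      ∑ z : ι → κ × κ with ∀ i, z (g i) = z i,
        if (fun k => ∑ l, wordContent z (k, l)) = α then
          mono (fun l => ∑ k, wordContent z (k, l)) else 0 := by
    intro g
    rw [coeffAt_fixedWords]
    unfold fixedWords
    rw [Finset.sum_smul]
    simp only [Finset.smul_sum, Finset.sum_filter]
    rw [← Equiv.sum_comp (Equiv.arrowProdEquivProdArrow ι (fun _ => κ) (fun _ => κ)).symm,
      Fintype.sum_prod_type]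
    refine Finset.sum_congr rfl fun w _ => ?_
    by_cases hw : ∀ i, w (g i) = w i
    · by_cases hα : wordContent w = α
      · rw [if_pos hα]
        refine Finset.sum_congr rfl fun v _ => ?_
        have e1 : (fun k => ∑ l, wordContent ((Equiv.arrowProdEquivProdArrow ι
            (fun _ => κ) (fun _ => κ)).symm (w, v)) (k, l)) = α := by
          rw [← hα]; funext k; exact (wordContent_fst ((Equiv.arrowProdEquivProdArrow ι (fun _ => κ) (fun _ => κ)).symm (w, v)) k).symm
        have e2 : (fun l => ∑ k, wordContent ((Equiv.arrowProdEquivProdArrow ι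
            (fun _ => κ) (fun _ => κ)).symm (w, v)) (k, l)) = wordContent v := by
          funext k; exact (wordContent_snd ((Equiv.arrowProdEquivProdArrow ι (fun _ => κ) (fun _ => κ)).symm (w, v)) k).symm
        rw [if_pos e1, e2]
        simp [hw, Prod.ext_iff, Equiv.arrowProdEquivProdArrow]
      · rw [if_neg hα]
        symm
        refine Finset.sum_eq_zero fun v _ => ?_
        rw [if_neg (c := ((fun k => ∑ l, wordContent ((Equiv.arrowProdEquivProdArrow ι
          (fun _ => κ) (fun _ => κ)).symm (w, v)) (k, l)) = α)), ite_self]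
        intro e
        apply hα
        rw [← e]; funext k; exact wordContent_fst ((Equiv.arrowProdEquivProdArrow ι (fun _ => κ) (fun _ => κ)).symm (w, v)) k
    · rw [if_neg hw]
      simp only [zero_smul, ite_self, Finset.sum_const_zero]
      symm
      refine Finset.sum_eq_zero fun v _ => ?_
      rw [if_neg]
      intro e
      exact hw fun i => congrArg Prod.fst (e i)
  rw [Finset.sum_congr rfl fun g _ => h1 g, sum_sum_fixed_words
    (F := fun γ : κ × κ → ℕ => if (fun k => ∑ l, γ (k, l)) = α then
          mono (fun l => ∑ k, γ (k, l)) else 0)]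
  congr 1
  unfold complete
  rw [Finset.prod_univ_sum, ← Finset.sum_filter]
  -- A matrix with row sums `α` is a choice, for each `k`, of a row, that is, of a monomial of
  -- degree `α k`.
  refine Finset.sum_bij' (fun γ _ k l => γ (k, l)) (fun B _ p => B p.1 p.2) ?_ ?_ ?_ ?_ ?_
  · intro γ hγ
    rw [Finset.mem_filter] at hγ
    simp only [Fintype.mem_piFinset, Finset.mem_piAntidiag, Finset.mem_univ, implies_true, and_true]
    exact fun k => congrFun hγ.2 k
  · intro B hB
    simp only [Fintype.mem_piFinset, Finset.mem_piAntidiag, Finset.mem_univ, implies_true,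
      and_true] at hB
    simp only [Finset.mem_filter, Finset.mem_piAntidiag, Finset.mem_univ, implies_true, and_true]
    refine ⟨?_, funext hB⟩
    rw [Fintype.sum_prod_type, ← h]
    exact Finset.sum_congr rfl fun k _ => hB k
  · intro γ _; rfl
  · intro B _; rfl
  · intro γ _
    rw [← mono_sum]
    congr 1
    funext l
    simp

end Polynomials

/-! ### Alternants and the Jacobi–Trudi determinant. -/

section JacobiTrudi

open Equiv MvPolynomial

variable {ι : Type*} [Fintype ι] [DecidableEq ι] {N : ℕ}

/-- The alternant `det (X_j ^ c_i)`. -/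
noncomputable def alternant (c : Fin N → ℕ) : MvPolynomial (Fin N) ℂ :=
  (Matrix.of fun i j => (X j : MvPolynomial (Fin N) ℂ) ^ c i).det

theorem alternant_eq_sum (c : Fin N → ℕ) :
    alternant c = ∑ σ : Perm (Fin N), ((Perm.sign σ : ℤ) : ℂ) • mono (c ∘ σ) := by
  unfold alternant
  rw [Matrix.det_apply']
  refine Finset.sum_congr rfl fun σ _ => ?_
  rw [mono_eq_prod, MvPolynomial.smul_eq_C_mul]
  simp

theorem alternant_ne_zero : alternant (fun i : Fin N => (i : ℕ)) ≠ 0 := by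
  have h : (Matrix.vandermonde (X : Fin N → MvPolynomial (Fin N) ℂ)).det ≠ 0 :=
    Matrix.det_vandermonde_ne_zero_iff.2 (X_injective)
  rw [← Matrix.det_transpose] at h
  exact h

theorem coeffAt_alternant_mul (c e : Fin N → ℕ) (P : MvPolynomial (Fin N) ℂ) :
    coeffAt e (alternant c * P) = ∑ σ : Perm (Fin N), ((Perm.sign σ : ℤ) : ℂ) *
      if ∀ i, c (σ i) ≤ e i then coeffAt (e - c ∘ σ) P else 0 := by
  rw [alternant_eq_sum, Finset.sum_mul, coeffAt_sum]
  refine Finset.sum_congr rfl fun σ _ => ?_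
  rw [smul_mul_assoc, coeffAt_smul, coeffAt_mono_mul]
  congr 2

/-- The virtual character given by the Jacobi–Trudi determinant. The strictly increasing `c` with
sum `card ι + 0 + 1 + ⋯ + (N - 1)` correspond to the partitions `c i - i` of `card ι`. -/
noncomputable def schurChar (c : Fin N → ℕ) (g : Perm ι) : ℂ :=
  coeffAt c (alternant (fun i : Fin N => (i : ℕ)) * fixedWords (Fin N) g)

theorem geom_mul {R : Type*} [CommRing R] (a : R) :
    PowerSeries.mk (fun n => a ^ n) * (1 - PowerSeries.C a * PowerSeries.X) = 1 := by
  ext n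
  rw [mul_sub, mul_one, mul_left_comm, ← mul_assoc, map_sub]
  cases n with
  | zero => simp
  | succ n =>
    rw [PowerSeries.coeff_succ_mul_X]
    simp [pow_succ']

theorem coeff_prod_geom (d : ℕ) :
    PowerSeries.coeff d (∏ l : Fin N, PowerSeries.mk
      (fun n => (X l : MvPolynomial (Fin N) ℂ) ^ n)) = complete (Fin N) d := by
  rw [PowerSeries.coeff_prod]
  unfold complete
  refine Finset.sum_bij' (fun l _ => ⇑l) (fun β _ => Finsupp.equivFunOnFinite.symm β) ?_ ?_ ?_ ?_ ?_
  · intro l hl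
    simp only [Finset.mem_finsuppAntidiag] at hl
    simp only [Finset.mem_piAntidiag, Finset.mem_univ, implies_true, and_true]
    exact hl.1
  · intro β hβ
    simp only [Finset.mem_piAntidiag, Finset.mem_univ, implies_true, and_true] at hβ
    simp only [Finset.mem_finsuppAntidiag, Finset.subset_univ, and_true]
    exact hβ
  · intro l _; ext; simp
  · intro l _; ext; simp
  · intro l _
    simp [mono_eq_prod]

/-- The coefficients of `∏_{l ≠ k} (1 - X_l T)`. -/
noncomputable def omitPoly (k : Fin N) : Polynomial (MvPolynomial (Fin N) ℂ) :=
  ∏ l ∈ Finset.univ.erase k, (1 - Polynomial.C (X l) * Polynomial.X)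

theorem omitPoly_coeff_eq_zero (k : Fin N) {j : ℕ} (hj : N ≤ j) : (omitPoly k).coeff j = 0 := by
  apply Polynomial.coeff_eq_zero_of_natDegree_lt
  refine lt_of_le_of_lt (Polynomial.natDegree_prod_le _ _) ?_
  refine lt_of_le_of_lt (Finset.sum_le_card_nsmul _ _ 1 ?_) ?_
  · intro l _
    refine (Polynomial.natDegree_sub_le _ _).trans ?_
    simp only [Polynomial.natDegree_one]
    refine max_le (Nat.zero_le _) ?_
    refine (Polynomial.natDegree_C_mul_le _ _).trans Polynomial.natDegree_X_le
  · rw [Finset.card_erase_of_mem (Finset.mem_univ _)]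
    simp only [Finset.card_univ, Fintype.card_fin, smul_eq_mul, mul_one]
    have := k.pos
    omega

/-- Compare coefficients of `T ^ d` in `∏_l (1 - X_l T)⁻¹ * ∏_{l ≠ k} (1 - X_l T) = (1 - X_k T)⁻¹`.
-/
theorem sum_omitPoly_mul_complete (k : Fin N) (d : ℕ) :
    ∑ j : Fin N, (if (j : ℕ) ≤ d then complete (Fin N) (d - j) else 0) * (omitPoly k).coeff j =
      X k ^ d := by
  have h1 : ((omitPoly k : Polynomial (MvPolynomial (Fin N) ℂ)) :
      PowerSeries (MvPolynomial (Fin N) ℂ)) *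
        ∏ l : Fin N, PowerSeries.mk (fun n => (X l : MvPolynomial (Fin N) ℂ) ^ n) =
      PowerSeries.mk fun n => X k ^ n := by
    have h2 : ((omitPoly k : Polynomial (MvPolynomial (Fin N) ℂ)) :
        PowerSeries (MvPolynomial (Fin N) ℂ)) = ∏ l ∈ Finset.univ.erase k,
          (1 - PowerSeries.C (X l) * PowerSeries.X) := by
      rw [omitPoly, ← Polynomial.coeToPowerSeries.ringHom_apply, map_prod]
      simp
    rw [h2, ← Finset.mul_prod_erase Finset.univ _ (Finset.mem_univ k), mul_left_comm,
      ← Finset.prod_mul_distrib, Finset.prod_eq_one, mul_one]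
    intro l _
    rw [mul_comm, geom_mul]
  have h3 := congrArg (PowerSeries.coeff d) h1
  rw [PowerSeries.coeff_mul, PowerSeries.coeff_mk] at h3
  simp only [coeff_prod_geom, Polynomial.coeff_coe] at h3
  rw [Finset.Nat.sum_antidiagonal_eq_sum_range_succ
    (fun i j => (omitPoly k).coeff i * complete (Fin N) j)] at h3
  rw [← h3, Fin.sum_univ_eq_sum_range (fun j : ℕ =>
    (if j ≤ d then complete (Fin N) (d - j) else 0) * (omitPoly k).coeff j) N]
  simp only [ite_mul, zero_mul]
  rw [← Finset.sum_filter]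
  symm
  refine Finset.sum_subset_zero_on_sdiff ?_ ?_ ?_ |>.symm
  · intro j
    simp only [Finset.mem_filter, Finset.mem_range]
    omega
  · intro j hj
    simp only [Finset.mem_sdiff, Finset.mem_filter, Finset.mem_range] at hj
    rw [omitPoly_coeff_eq_zero k (by omega), zero_mul]
  · intro j _
    exact mul_comm _ _

/-- The matrix of the Jacobi–Trudi determinant. -/
noncomputable def completeMatrix (c : Fin N → ℕ) :
    Matrix (Fin N) (Fin N) (MvPolynomial (Fin N) ℂ) :=
  Matrix.of fun i j => if (j : ℕ) ≤ c i then complete (Fin N) (c i - j) else 0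

theorem complete_zero : complete (Fin N) 0 = 1 := by
  simp [complete, mono_zero]

/-- The matrix of powers is `completeMatrix c` times a matrix independent of `c`. For `c i = i` the
first factor is unitriangular, which identifies the determinant of the second with the Vandermonde
alternant. -/
theorem alternant_eq_det_completeMatrix_mul (c : Fin N → ℕ) :
    alternant c = (completeMatrix c).det * alternant fun i : Fin N => (i : ℕ) := by
  have h : ∀ c : Fin N → ℕ, alternant c = (completeMatrix c).det *
      (Matrix.of fun j k : Fin N => (omitPoly k).coeff j).det := by
    intro c
    rw [← Matrix.det_mul]
    unfold alternant
    congr 1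
    ext1 i k
    rw [Matrix.mul_apply]
    exact (sum_omitPoly_mul_complete k (c i)).symm
  have h1 : (completeMatrix fun i : Fin N => (i : ℕ)).det = 1 := by
    rw [Matrix.det_of_isLowerTriangular]
    · refine Finset.prod_eq_one fun i _ => ?_
      simp [completeMatrix, complete_zero]
    · intro i j hij
      have : ¬ ((j : ℕ) ≤ i) := not_le.2 hij
      rw [completeMatrix, Matrix.of_apply, if_neg this]
  rw [h c, h fun i : Fin N => (i : ℕ), h1, one_mul]

/-- `schurChar c` is the signed sum of the permutation characters of contents `c - σ`, and the
Cauchy identity turns each of them into a product of complete homogeneous polynomials. -/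
theorem sum_schurChar_smul_fixedWords {c : Fin N → ℕ}
    (hc : ∑ i, c i = Fintype.card ι + ∑ i : Fin N, (i : ℕ)) :
    ∑ g : Perm ι, schurChar c g • fixedWords (Fin N) g =
      (Fintype.card ι).factorial • (completeMatrix c).det := by
  simp only [schurChar, coeffAt_alternant_mul, Finset.sum_smul]
  rw [Finset.sum_comm, ← Matrix.det_transpose, Matrix.det_apply', Finset.smul_sum]
  refine Finset.sum_congr rfl fun σ _ => ?_
  simp only [mul_smul, ← Finset.smul_sum]
  rw [MvPolynomial.smul_eq_C_mul, ← mul_smul_comm]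
  refine congrArg₂ (· * ·) (by simp) ?_
  · rw [nsmul_eq_mul]
    by_cases h : ∀ i, (σ i : ℕ) ≤ c i
    · simp only [if_pos h]
      rw [sum_coeffAt_smul_fixedWords, nsmul_eq_mul]
      · congr 1
        refine Finset.prod_congr rfl fun i _ => ?_
        have hi : (σ i : ℕ) ≤ c i := h i
        simp [completeMatrix, hi]
      · have h2 : ∑ i, ((σ i : Fin N) : ℕ) = ∑ i : Fin N, (i : ℕ) :=
          Equiv.sum_comp σ fun i : Fin N => (i : ℕ)
        have h3 : ∑ i, (c - (fun i : Fin N => (i : ℕ)) ∘ σ) i + ∑ i, ((σ i : Fin N) : ℕ) =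
            ∑ i, c i := by
          rw [← Finset.sum_add_distrib]
          exact Finset.sum_congr rfl fun i _ => Nat.sub_add_cancel (h i)
        omega
    · simp only [if_neg h, zero_smul, Finset.sum_const_zero]
      symm
      rw [not_forall] at h
      obtain ⟨i, hi⟩ := h
      rw [Finset.prod_eq_zero (Finset.mem_univ i), mul_zero]
      rw [Matrix.transpose_apply, completeMatrix, Matrix.of_apply, if_neg hi]

/-- The characteristic of `schurChar c` is a factorial times the Schur polynomial, a quotient of
alternants. -/
theorem alternant_mul_sum_schurChar {c : Fin N → ℕ}
    (hc : ∑ i, c i = Fintype.card ι + ∑ i : Fin N, (i : ℕ)) :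
    alternant (fun i : Fin N => (i : ℕ)) * ∑ g : Perm ι, schurChar c g • fixedWords (Fin N) g =
      (Fintype.card ι).factorial • alternant c := by
  rw [sum_schurChar_smul_fixedWords hc, alternant_eq_det_completeMatrix_mul c, mul_smul_comm,
    mul_comm]

end JacobiTrudi

/-! ### Symmetric polynomials and injectivity of the characteristic. -/

section Symmetric

open Equiv MvPolynomial

variable {ι κ : Type*} [Fintype ι] [DecidableEq ι] [Fintype κ] [DecidableEq κ] {N : ℕ}

/-- Symmetry of a polynomial in terms of its coefficients. -/
def SymmetricCoeffs (P : MvPolynomial κ ℂ) : Prop :=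
  ∀ (σ : Perm κ) (α : κ → ℕ), coeffAt (α ∘ σ) P = coeffAt α P

theorem symmetricCoeffs_fixedWords (g : Perm ι) : SymmetricCoeffs (fixedWords κ g) := by
  intro σ α
  rw [coeffAt_fixedWords, coeffAt_fixedWords]
  have hc : ∀ (τ : Perm κ) (w : ι → κ) k, wordContent (τ ∘ w) (τ k) = wordContent w k := by
    intro τ w k
    simp [wordContent]
  refine Finset.sum_bij' (fun w _ => σ ∘ w) (fun w _ => σ.symm ∘ w) ?_ ?_ ?_ ?_ ?_
  · intro w hw
    simp only [Finset.mem_filter, Finset.mem_univ, true_and] at hw ⊢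
    funext k
    have := hc σ w (σ.symm k)
    rw [Equiv.apply_symm_apply] at this
    rw [this, hw]; simp
  · intro w hw
    simp only [Finset.mem_filter, Finset.mem_univ, true_and] at hw ⊢
    funext k
    have := hc σ.symm w (σ k)
    rw [Equiv.symm_apply_apply] at this
    rw [this, hw]; rfl
  · intro w _; funext i; simp
  · intro w _; funext i; simp
  · intro w _; simp

theorem SymmetricCoeffs.sum_smul {σ : Type*} {s : Finset σ} {P : σ → MvPolynomial κ ℂ}
    (h : ∀ i ∈ s, SymmetricCoeffs (P i)) (f : σ → ℂ) : SymmetricCoeffs (∑ i ∈ s, f i • P i) := by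
  intro τ α
  simp only [coeffAt_sum, coeffAt_smul]
  exact Finset.sum_congr rfl fun i hi => by rw [h i hi]

theorem SymmetricCoeffs.sub {P Q : MvPolynomial κ ℂ} (hP : SymmetricCoeffs P)
    (hQ : SymmetricCoeffs Q) : SymmetricCoeffs (P - Q) := by
  intro τ α
  rw [coeffAt_sub, coeffAt_sub, hP, hQ]

theorem coeffAt_comp_alternant_mul {P : MvPolynomial (Fin N) ℂ} (hP : SymmetricCoeffs P)
    (c e : Fin N → ℕ) (τ : Perm (Fin N)) :
    coeffAt (e ∘ τ) (alternant c * P) =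
      ((Perm.sign τ : ℤ) : ℂ) * coeffAt e (alternant c * P) := by
  rw [coeffAt_alternant_mul, coeffAt_alternant_mul, Finset.mul_sum]
  refine Fintype.sum_equiv (Equiv.mulRight τ⁻¹) _ _ fun σ => ?_
  have h1 : (∀ i, c (σ i) ≤ (e ∘ τ) i) ↔
      ∀ i, c ((Equiv.mulRight τ⁻¹ σ : Perm (Fin N)) i) ≤ e i := by
    constructor
    · intro h i
      simpa using h (τ⁻¹ i)
    · intro h i
      simpa using h (τ i)
  have h2 : e ∘ τ - c ∘ σ = (e - c ∘ (Equiv.mulRight τ⁻¹ σ : Perm (Fin N))) ∘ τ := by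
    funext i; simp
  rw [← mul_assoc]
  congr 1
  · simp only [coe_mulRight, Perm.sign_mul, Perm.sign_inv]
    have hs : ((Perm.sign τ : ℤ) : ℂ) * ((Perm.sign τ : ℤ) : ℂ) = 1 := by
      rcases Int.units_eq_one_or (Perm.sign τ) with h | h <;> simp [h]
    push_cast
    rw [mul_comm ((Perm.sign σ : ℤ) : ℂ), ← mul_assoc, hs, one_mul]
  · rw [h2, hP]
    exact if_congr h1 rfl rfl

/-- The product with the alternant is alternating: its coefficients vanish at exponents with a
repetition, and sorting reduces the others to strictly increasing ones. Then the nonzero alternant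
cancels. -/
theorem SymmetricCoeffs.eq_zero {P : MvPolynomial (Fin N) ℂ} (hP : SymmetricCoeffs P)
    (h : ∀ d : Fin N → ℕ, StrictMono d →
      coeffAt d (alternant (fun i : Fin N => (i : ℕ)) * P) = 0) : P = 0 := by
  have h0 : alternant (fun i : Fin N => (i : ℕ)) * P = 0 := by
    refine coeffAt_ext fun e => ?_
    rw [show coeffAt e (0 : MvPolynomial (Fin N) ℂ) = 0 from coeff_zero _]
    by_cases he : Function.Injective e
    · have hs : StrictMono (e ∘ Tuple.sort e) :=
        (Tuple.monotone_sort e).strictMono_of_injective (he.comp (Tuple.sort e).injective)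
      have h1 := h _ hs
      rw [coeffAt_comp_alternant_mul hP] at h1
      refine (mul_eq_zero.1 h1).resolve_left ?_
      rcases Int.units_eq_one_or (Perm.sign (Tuple.sort e)) with h | h <;> simp [h]
    · simp only [Function.Injective, not_forall] at he
      obtain ⟨i, j, hij, hne⟩ := he
      have h1 := coeffAt_comp_alternant_mul hP (fun i : Fin N => (i : ℕ)) e (swap i j)
      have h2 : e ∘ swap i j = e := by
        funext k
        simp only [Function.comp_apply, swap_apply_def]
        split_ifs with h1 h2
        · rw [h1, hij]
        · rw [h2, hij]
        · rfl
      rw [h2, Perm.sign_swap hne] at h1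
      simp only [Units.val_neg, Units.val_one, Int.cast_neg, Int.cast_one, neg_mul, one_mul] at h1
      exact self_eq_neg.1 h1
  exact (mul_eq_zero.1 h0).resolve_left alternant_ne_zero

theorem coeffAt_alternant {c d : Fin N → ℕ} (hc : StrictMono c) (hd : StrictMono d) :
    coeffAt d (alternant c) = if c = d then 1 else 0 := by
  rw [alternant_eq_sum, coeffAt_sum]
  simp only [coeffAt_smul, coeffAt_mono]
  have h : ∀ σ : Perm (Fin N), c ∘ σ = d ↔ c = d ∧ σ = 1 := by
    intro σ
    constructor
    · intro h
      have hcd : c = d := by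
        refine (StrictMono.range_inj hc hd).1 ?_
        rw [← h, Set.range_comp, σ.surjective.range_eq, Set.image_univ]
      refine ⟨hcd, ?_⟩
      ext i
      have := congrFun h i
      rw [← hcd] at this
      exact congrArg Fin.val (hc.injective this)
    · rintro ⟨rfl, rfl⟩
      rfl
  simp only [h]
  by_cases hcd : c = d
  · simp [hcd]
  · simp [hcd]

/-- With at least `Fintype.card ι` variables every word can be relabelled in the alphabet `Fin N`,
so the coefficients see all Young subgroup sums. -/
theorem IsCentralFun.eq_zero_of_sum_smul_fixedWords {f : Perm ι → ℂ} (hf : IsCentralFun f)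
    (hN : Fintype.card ι ≤ N) (h : ∑ g, f g • fixedWords (Fin N) g = 0) : f = 0 := by
  refine hf.eq_zero_of_stabSum fun w => ?_
  have e : ι ↪ Fin N := Classical.choice (Function.Embedding.nonempty_of_card_le (by simpa using hN))
  have h1 := coeffAt_sum_smul_fixedWords hf (e ∘ w)
  rw [h, show coeffAt _ (0 : MvPolynomial (Fin N) ℂ) = 0 from coeff_zero _,
    stabSum_comp_injective f w e e.injective] at h1
  refine (mul_eq_zero.1 h1.symm).resolve_left ?_
  refine Nat.cast_ne_zero.2 ?_
  exact Finset.card_ne_zero_of_mem (a := e ∘ w) (by simp)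

theorem fixedWords_conj (g h : Perm ι) : fixedWords κ (h * g * h⁻¹) = fixedWords κ g := by
  unfold fixedWords
  refine Finset.sum_bij' (fun w _ => w ∘ h) (fun w _ => w ∘ (h⁻¹ : Perm ι)) ?_ ?_ ?_ ?_ ?_
  · intro w hw
    simp only [Finset.mem_filter, Finset.mem_univ, true_and, Function.comp_apply] at hw ⊢
    intro i
    simpa using hw (h i)
  · intro w hw
    simp only [Finset.mem_filter, Finset.mem_univ, true_and, Function.comp_apply] at hw ⊢
    intro i
    simpa using hw (h⁻¹ i)
  · intro w _; funext i; simp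
  · intro w _; funext i; simp
  · intro w _; rw [wordContent_comp_perm]

theorem isCentralFun_coeffAt_fixedWords (α : κ → ℕ) :
    IsCentralFun fun g : Perm ι => coeffAt α (fixedWords κ g) :=
  isCentralFun_of_conj fun g h => by rw [fixedWords_conj]

theorem isCentralFun_schurChar (c : Fin N → ℕ) :
    IsCentralFun (schurChar c : Perm ι → ℂ) :=
  isCentralFun_of_conj fun g h => by unfold schurChar; rw [fixedWords_conj]

/-- This is the permutation character on the words of content `α`. For each word `w` the kernel is
the Gram matrix of the basis vectors indexed by `w ∘ x`. -/
theorem isPosDefFun_coeffAt_fixedWords (α : κ → ℕ) :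
    IsPosDefFun fun g : Perm ι => coeffAt α (fixedWords κ g) := by
  simp only [coeffAt_fixedWords]
  refine IsPosDefFun.sum fun w _ => ?_
  refine isPosDefFun_of_kernel (T := ι → κ)
    (fun x v => if (fun i => w (x i)) = v then 1 else 0) fun x y => ?_
  simp only [apply_ite star, star_one, star_zero, mul_ite, mul_one, mul_zero]
  rw [Finset.sum_ite_eq]
  simp only [Finset.mem_univ, if_true, funext_iff]
  refine if_congr ⟨fun h i => ?_, fun h i => ?_⟩ rfl rfl
  · simpa using h (y i)
  · simpa using h (y⁻¹ i)

end Symmetric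

/-! ### Averaged Young symmetrizers. -/

section Tableaux

open Equiv

variable {ι κ : Type*} [Fintype ι] [DecidableEq ι] [DecidableEq κ] {N : ℕ}

/-- The Young subgroup of a word. -/
def wordStab (w : ι → κ) : Subgroup (Perm ι) where
  carrier := {g | ∀ i, w (g i) = w i}
  one_mem' := fun _ => rfl
  mul_mem' := fun {g h} hg hh i => (hg (h i)).trans (hh i)
  inv_mem' := fun {g} hg i => by
    have := hg (g⁻¹ i)
    simpa using this.symm

instance (w : ι → κ) : DecidablePred (· ∈ wordStab w) :=
  fun g => inferInstanceAs (Decidable (∀ i, w (g i) = w i))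

/-- The function of the Young symmetrizer made from the row group of `row` and the column group
of `col`, averaged over conjugation. -/
noncomputable def youngFun (row : ι → κ) (col : ι → ℕ) (x : Perm ι) : ℂ :=
  ∑ h : Perm ι, ∑ p : wordStab row, ∑ q : wordStab col,
    ((Perm.sign (q : Perm ι) : ℤ) : ℂ) * if h * x * h⁻¹ = p * q then 1 else 0

theorem sum_conj_ite_central (x y z : Perm ι) :
    ∑ h : Perm ι, (if h * x * h⁻¹ = z * y * z⁻¹ then (1 : ℂ) else 0) =
      ∑ h : Perm ι, if h * x * h⁻¹ = y then 1 else 0 := by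
  refine Fintype.sum_equiv (Equiv.mulLeft z⁻¹) _ _ fun h => ?_
  refine if_congr ⟨fun e => ?_, fun e => ?_⟩ rfl rfl
  · simp only [coe_mulLeft]
    calc z⁻¹ * h * x * (z⁻¹ * h)⁻¹ = z⁻¹ * (h * x * h⁻¹) * z := by group
      _ = y := by rw [e]; group
  · simp only [coe_mulLeft] at e
    rw [← e]; group

theorem youngFun_eq (row : ι → κ) (col : ι → ℕ) (x : Perm ι) :
    youngFun row col x = ∑ p : wordStab row, ∑ q : wordStab col,
      ((Perm.sign (q : Perm ι) : ℤ) : ℂ) *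
        ∑ h : Perm ι, if h * x * h⁻¹ = p * q then 1 else 0 := by
  unfold youngFun
  rw [Finset.sum_comm]
  refine Finset.sum_congr rfl fun p _ => ?_
  rw [Finset.sum_comm]
  simp only [Finset.mul_sum]

theorem isCentralFun_youngFun (row : ι → κ) (col : ι → ℕ) : IsCentralFun (youngFun row col) := by
  refine isCentralFun_of_conj fun g k => ?_
  unfold youngFun
  refine Fintype.sum_equiv (Equiv.mulRight k) _ _ fun h => ?_
  have : h * (k * g * k⁻¹) * h⁻¹ = Equiv.mulRight k h * g * (Equiv.mulRight k h)⁻¹ := by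
    simp only [coe_mulRight]; group
  rw [this]

theorem sum_youngFun_mul (row : ι → κ) (col : ι → ℕ) {f : Perm ι → ℂ} (hf : IsCentralFun f) :
    ∑ x, youngFun row col x * f x = (Fintype.card ι).factorial *
      ∑ p : wordStab row, ∑ q : wordStab col, ((Perm.sign (q : Perm ι) : ℤ) : ℂ) * f (p * q) := by
  simp only [youngFun_eq, Finset.sum_mul]
  rw [Finset.sum_comm, Finset.mul_sum]
  refine Finset.sum_congr rfl fun p _ => ?_
  rw [Finset.sum_comm, Finset.mul_sum]
  refine Finset.sum_congr rfl fun q _ => ?_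
  have h2 : ∀ x : Perm ι, ((Perm.sign (q : Perm ι) : ℤ) : ℂ) *
      (∑ h : Perm ι, if h * x * h⁻¹ = (p : Perm ι) * q then (1 : ℂ) else 0) * f x =
      ((Perm.sign (q : Perm ι) : ℤ) : ℂ) *
        ∑ h : Perm ι, (if h * x * h⁻¹ = (p : Perm ι) * q then (1 : ℂ) else 0) * f x := fun x => by
    rw [mul_assoc, Finset.sum_mul]
  rw [Finset.sum_congr rfl fun x _ => h2 x, ← Finset.mul_sum, Finset.sum_comm, mul_left_comm]
  congr 1
  have h1 : ∀ h : Perm ι, ∑ x : Perm ι, (if h * x * h⁻¹ = (p : Perm ι) * q then (1 : ℂ) else 0) *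
      f x = f (p * q) := by
    intro h
    rw [Finset.sum_eq_single (h⁻¹ * (p * q) * h)]
    · rw [if_pos (by group), one_mul]
      have := hf.conj ((p : Perm ι) * q) h⁻¹
      rwa [inv_inv] at this
    · intro x _ hx
      rw [if_neg, zero_mul]
      intro e
      apply hx
      rw [← e]; group
    · simp
  rw [Finset.sum_congr rfl fun h _ => h1 h]
  simp [Fintype.card_perm]

/-- The row group and the column group meet trivially, so `1 = p * q` only for `p = q = 1`. -/
theorem youngFun_one {row : ι → κ} {col : ι → ℕ}
    (hinj : ∀ i j, row i = row j → col i = col j → i = j) :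
    youngFun row col 1 = (Fintype.card ι).factorial := by
  have h1 : ∑ p : wordStab row, ∑ q : wordStab col,
      ((Perm.sign (q : Perm ι) : ℤ) : ℂ) * (if 1 = (p : Perm ι) * q then 1 else 0) = 1 := by
    have hone : ∀ (p : wordStab row) (q : wordStab col), 1 = (p : Perm ι) * q → p = 1 ∧ q = 1 := by
      intro p q h
      have hq : (q : Perm ι) = 1 := by
        ext i
        refine hinj _ _ ?_ (q.2 i)
        have h2 : (q : Perm ι) = (p : Perm ι)⁻¹ := eq_inv_of_mul_eq_one_right h.symm
        rw [h2]
        exact (wordStab row).inv_mem p.2 i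
      refine ⟨Subtype.ext ?_, Subtype.ext hq⟩
      rw [hq, mul_one] at h
      exact h.symm
    rw [Finset.sum_eq_single 1, Finset.sum_eq_single 1]
    · simp
    · intro q _ hq
      rw [if_neg fun h => hq (hone _ _ h).2, mul_zero]
    · simp
    · intro p _ hp
      refine Finset.sum_eq_zero fun q _ => ?_
      rw [if_neg fun h => hp (hone _ _ h).1, mul_zero]
    · simp
  unfold youngFun
  simp only [mul_one, mul_inv_cancel, h1]
  simp [Fintype.card_perm]

/-- Let `a` be the row symmetrizer and `b` the column antisymmetrizer; `u` is the coefficient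
function of `b * a`. The autocorrelation of `u` belongs to `(b * a) * (b * a)ᴴ = b * a * a * b`.
Averaging over conjugation permits cyclic rotation to `a * a * b * b`, a multiple of `a * b` by the
product of the two group orders. -/
theorem isPosDefFun_youngFun (row : ι → κ) (col : ι → ℕ) : IsPosDefFun (youngFun row col) := by
  let u : Perm ι → ℂ := fun s => ∑ q : wordStab col, ∑ p : wordStab row,
    ((Perm.sign (q : Perm ι) : ℤ) : ℂ) * if (q : Perm ι) * p = s then 1 else 0
  have hu : ∀ s, star (u s) = u s := by
    intro s
    simp only [u, star_sum, star_mul', apply_ite star, star_one, star_zero]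
    simp
  have hK : IsPosDefFun fun y => ∑ t, u (y * t) * u t := by
    refine isPosDefFun_of_kernel (fun x t => u (x * t)) fun x y => ?_
    refine Fintype.sum_equiv (Equiv.mulLeft y⁻¹) _ _ fun t => ?_
    rw [hu]
    simp [mul_assoc]
  have hsum : IsPosDefFun fun x => ∑ h : Perm ι, ∑ t, u (h * x * h⁻¹ * t) * u t :=
    IsPosDefFun.sum fun h _ => hK.comp_hom (MulAut.conj h).toMonoidHom
  have hval : ∀ x, ∑ h : Perm ι, ∑ t, u (h * x * h⁻¹ * t) * u t =
      (Fintype.card (wordStab row) * Fintype.card (wordStab col) : ℂ) * youngFun row col x := by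
    intro x
    let E : Perm ι → ℂ := fun y => ∑ h : Perm ι, if h * x * h⁻¹ = y then 1 else 0
    have hE : IsCentralFun E := isCentralFun_of_conj fun y z => sum_conj_ite_central x y z
    have h1 : ∀ h : Perm ι, ∑ t, u (h * x * h⁻¹ * t) * u t =
        ∑ q' : wordStab col, ∑ p' : wordStab row, ∑ q : wordStab col, ∑ p : wordStab row,
          ((Perm.sign (q' : Perm ι) : ℤ) : ℂ) * ((Perm.sign (q : Perm ι) : ℤ) : ℂ) *
            if h * x * h⁻¹ = (q : Perm ι) * p * (p' : Perm ι)⁻¹ * (q' : Perm ι)⁻¹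
              then 1 else 0 := by
      intro h
      have h2 : ∀ t, u (h * x * h⁻¹ * t) * u t =
          ∑ q' : wordStab col, ∑ p' : wordStab row, if (q' : Perm ι) * p' = t then
            ((Perm.sign (q' : Perm ι) : ℤ) : ℂ) * u (h * x * h⁻¹ * t) else 0 := by
        intro t
        simp only [u, Finset.mul_sum (Finset.univ : Finset (wordStab col)),
          Finset.mul_sum (Finset.univ : Finset (wordStab row))]
        refine Finset.sum_congr rfl fun q' _ => Finset.sum_congr rfl fun p' _ => ?_
        split_ifs
        · rw [mul_one, mul_comm]
          simp only [Finset.mul_sum]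
        · simp
      simp only [h2]
      rw [Finset.sum_comm]
      refine Finset.sum_congr rfl fun q' _ => ?_
      rw [Finset.sum_comm]
      refine Finset.sum_congr rfl fun p' _ => ?_
      rw [Finset.sum_ite_eq]
      simp only [Finset.mem_univ, if_true, u, Finset.mul_sum]
      refine Finset.sum_congr rfl fun q _ => Finset.sum_congr rfl fun p _ => ?_
      have hiff : (q : Perm ι) * p = h * x * h⁻¹ * (q' * p') ↔
          h * x * h⁻¹ = (q : Perm ι) * p * (p' : Perm ι)⁻¹ * (q' : Perm ι)⁻¹ :=
        ⟨fun e => by rw [e]; group, fun e => by rw [e]; group⟩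
      simp only [hiff, mul_assoc ((Perm.sign (q' : Perm ι) : ℤ) : ℂ)]
    rw [Finset.sum_congr rfl fun h _ => h1 h, Finset.sum_comm]
    have h3 : ∀ (q' : wordStab col), ∑ h : Perm ι, ∑ p' : wordStab row, ∑ q : wordStab col,
        ∑ p : wordStab row, ((Perm.sign (q' : Perm ι) : ℤ) : ℂ) *
          ((Perm.sign (q : Perm ι) : ℤ) : ℂ) *
            (if h * x * h⁻¹ = (q : Perm ι) * p * (p' : Perm ι)⁻¹ * (q' : Perm ι)⁻¹
              then 1 else 0) = Fintype.card (wordStab row) * youngFun row col x := by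
      intro q'
      rw [Finset.sum_comm]
      have h4 : ∀ p' : wordStab row, ∑ h : Perm ι, ∑ q : wordStab col,
          ∑ p : wordStab row, ((Perm.sign (q' : Perm ι) : ℤ) : ℂ) *
            ((Perm.sign (q : Perm ι) : ℤ) : ℂ) *
              (if h * x * h⁻¹ = (q : Perm ι) * p * (p' : Perm ι)⁻¹ * (q' : Perm ι)⁻¹
                then 1 else 0) = youngFun row col x := by
        intro p'
        rw [Finset.sum_comm]
        have h5 : ∀ q : wordStab col, ∑ h : Perm ι, ∑ p : wordStab row,
            ((Perm.sign (q' : Perm ι) : ℤ) : ℂ) * ((Perm.sign (q : Perm ι) : ℤ) : ℂ) *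
              (if h * x * h⁻¹ = (q : Perm ι) * p * (p' : Perm ι)⁻¹ * (q' : Perm ι)⁻¹
                then 1 else 0) = ((Perm.sign ((q'⁻¹ * q : wordStab col) : Perm ι) : ℤ) : ℂ) *
                  ∑ p : wordStab row, E (p * (q'⁻¹ * q : wordStab col)) := by
          intro q
          rw [Finset.sum_comm, Finset.mul_sum]
          refine Fintype.sum_equiv (Equiv.mulRight p'⁻¹) _ _ fun p => ?_
          rw [← Finset.mul_sum]
          congr 1
          · simp [Perm.sign_mul]
          · have := hE ((q : Perm ι)) (p * (p' : Perm ι)⁻¹ * (q' : Perm ι)⁻¹)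
            simp only [E] at this ⊢
            simp only [mul_assoc] at this ⊢
            rw [this]
            simp [mul_assoc]
        rw [Finset.sum_congr rfl fun q _ => h5 q]
        refine (Equiv.sum_comp (Equiv.mulLeft q'⁻¹) (fun q : wordStab col => ((Perm.sign (q : Perm ι) : ℤ) : ℂ) *
            ∑ p : wordStab row, E (p * q))).trans ?_
        rw [youngFun_eq, Finset.sum_comm]
        simp only [Finset.mul_sum, E]
      rw [Finset.sum_congr rfl fun p' _ => h4 p']
      simp
    rw [Finset.sum_congr rfl fun q' _ => h3 q']
    simp
    ring
  have hcard : (0 : ℂ) < Fintype.card (wordStab row) * Fintype.card (wordStab col) := by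
    exact_mod_cast Nat.mul_pos Fintype.card_pos Fintype.card_pos
  have h := hsum.const_mul (inv_nonneg.2 hcard.le)
  convert h using 1
  funext x
  rw [hval, inv_mul_cancel_left₀ hcard.ne']

/-- Right multiplication by the transposition stays in the column group and reverses the sign, so
the terms cancel in pairs. -/
theorem sum_sign_mul_eq_zero (col : ι → ℕ) {i j : ι} (hij : i ≠ j) (hcol : col i = col j)
    (f : Perm ι → ℂ) (hf : ∀ q, f (q * swap i j) = f q) :
    ∑ q : wordStab col, ((Perm.sign (q : Perm ι) : ℤ) : ℂ) * f q = 0 := by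
  let τ : wordStab col := ⟨swap i j, by
    intro k
    rw [swap_apply_def]
    split_ifs with h1 h2
    · rw [h1, hcol]
    · rw [h2, hcol]
    · rfl⟩
  have h := Equiv.sum_comp (Equiv.mulRight τ)
    (fun q : wordStab col => ((Perm.sign (q : Perm ι) : ℤ) : ℂ) * f q)
  have h2 : ∀ q : wordStab col, ((Perm.sign ((Equiv.mulRight τ q : wordStab col) : Perm ι) : ℤ) : ℂ)
      * f (Equiv.mulRight τ q : wordStab col) = -(((Perm.sign (q : Perm ι) : ℤ) : ℂ) * f q) := by
    intro q
    have : ((Equiv.mulRight τ q : wordStab col) : Perm ι) = q * swap i j := rfl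
    rw [this, hf, Perm.sign_mul, Perm.sign_swap hij]
    push_cast
    ring
  rw [Finset.sum_congr rfl fun q _ => h2 q, Finset.sum_neg_distrib] at h
  exact self_eq_neg.1 h.symm

/-- If a coefficient of the symmetric polynomial of `youngFun row col` does not vanish, then there
is a word of that content without repetitions in the columns. -/
theorem exists_word_of_coeff_youngFun_ne_zero [Fintype κ] {κ' : Type*} [Fintype κ'] [DecidableEq κ']
    {row : ι → κ} {col : ι → ℕ} {α : κ' → ℕ}
    (h : ∑ g, youngFun row col g * coeffAt α (fixedWords κ' g) ≠ 0) :
    ∃ w : ι → κ', wordContent w = α ∧ ∀ i j, col i = col j → w i = w j → i = j := by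
  by_contra hcon
  push Not at hcon
  apply h
  rw [sum_youngFun_mul row col (isCentralFun_coeffAt_fixedWords α)]
  rw [Finset.sum_eq_zero, mul_zero]
  intro p _
  simp only [coeffAt_fixedWords, Finset.mul_sum]
  rw [Finset.sum_comm]
  refine Finset.sum_eq_zero fun w hw => ?_
  obtain ⟨i, j, hcol, hwij, hij⟩ := hcon w (Finset.mem_filter.1 hw).2
  refine sum_sign_mul_eq_zero col hij hcol
    (fun q => if ∀ k, w (((p : Perm ι) * q) k) = w k then 1 else 0) fun q => ?_
  have hsw : ∀ k, w (swap i j k) = w k := by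
    intro k
    rw [swap_apply_def]
    split_ifs with h1 h2
    · rw [h1, hwij]
    · rw [h2, hwij]
    · rfl
  refine if_congr ⟨fun H k => ?_, fun H k => ?_⟩ rfl rfl
  · have := H (swap i j k)
    rw [hsw] at this
    simpa [← mul_assoc] using this
  · have := H (swap i j k)
    rw [hsw] at this
    simpa [← mul_assoc] using this

/-- If two functions `youngFun` are not orthogonal, then the rows of the second one give a word
without repetitions in the columns of the first one. -/
theorem exists_perm_of_sum_youngFun_mul_ne_zero {κ' : Type*} [DecidableEq κ'] {row : ι → κ}
    {row' : ι → κ'} {col col' : ι → ℕ}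
    (h : ∑ g, youngFun row col g * youngFun row' col' g ≠ 0) :
    ∃ g : Perm ι, ∀ i j, col i = col j → row' (g i) = row' (g j) → i = j := by
  by_contra hcon
  push Not at hcon
  apply h
  rw [sum_youngFun_mul row col (isCentralFun_youngFun row' col')]
  rw [Finset.sum_eq_zero, mul_zero]
  intro p _
  -- Summing out the row group turns the second function into a signed count of conjugates of `x` in
  -- cosets of that group. Such membership is insensitive to a transposition of two cells whose
  -- images under `g` share a row.
  have h1 : ∀ x, youngFun row' col' x = ∑ h : Perm ι, ∑ q' : wordStab col',
      ((Perm.sign (q' : Perm ι) : ℤ) : ℂ) *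
        if ∀ k, row' (((q' : Perm ι)⁻¹ * (h * x * h⁻¹)) k) = row' k then 1 else 0 := by
    intro x
    rw [youngFun_eq, Finset.sum_comm, Finset.sum_comm (s := (Finset.univ : Finset (Perm ι)))]
    refine Finset.sum_congr rfl fun q' _ => ?_
    rw [← Finset.mul_sum, ← Finset.mul_sum]
    congr 1
    have h2 : ∀ p' : wordStab row', ∑ h : Perm ι,
        (if h * x * h⁻¹ = (p' : Perm ι) * q' then (1 : ℂ) else 0) =
          ∑ h : Perm ι, if h * x * h⁻¹ = (q' : Perm ι) * p' then 1 else 0 := by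
      intro p'
      rw [← sum_conj_ite_central x ((q' : Perm ι) * p') p']
      simp [mul_assoc]
    rw [Finset.sum_congr rfl fun p' _ => h2 p', Finset.sum_comm]
    refine Finset.sum_congr rfl fun h _ => ?_
    by_cases hk : ∀ k, row' (((q' : Perm ι)⁻¹ * (h * x * h⁻¹)) k) = row' k
    · rw [if_pos hk, Finset.sum_eq_single (⟨(q' : Perm ι)⁻¹ * (h * x * h⁻¹), hk⟩ : wordStab row')]
      · simp
      · intro p' _ hp'
        rw [if_neg]
        intro e
        apply hp'
        refine Subtype.ext ?_
        change (p' : Perm ι) = (q' : Perm ι)⁻¹ * (h * x * h⁻¹)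
        rw [e, inv_mul_cancel_left]
      · simp
    · rw [if_neg hk]
      refine Finset.sum_eq_zero fun p' _ => ?_
      rw [if_neg]
      intro e
      apply hk
      rw [e]
      intro k
      simpa using p'.2 k
  simp only [h1, Finset.mul_sum]
  rw [Finset.sum_comm]
  refine Finset.sum_eq_zero fun g _ => ?_
  rw [Finset.sum_comm]
  refine Finset.sum_eq_zero fun q' _ => ?_
  obtain ⟨i, j, hcol, hrow, hij⟩ := hcon g
  refine sum_sign_mul_eq_zero col hij hcol (fun q => ((Perm.sign (q' : Perm ι) : ℤ) : ℂ) *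
    if ∀ k, row' (((q' : Perm ι)⁻¹ * (g * ((p : Perm ι) * q) * g⁻¹)) k) = row' k then 1 else 0)
    fun q => ?_
  have hsw : ∀ k, row' (g (swap i j (g⁻¹ k))) = row' k := by
    intro k
    rw [swap_apply_def]
    split_ifs with h1 h2
    · rw [← hrow, ← h1]; simp
    · rw [hrow, ← h2]; simp
    · simp
  congr 1
  refine if_congr ⟨fun H k => ?_, fun H k => ?_⟩ rfl rfl
  · have := H (g (swap i j (g⁻¹ k)))
    rw [hsw] at this
    simpa [← mul_assoc] using this
  · have := H (g (swap i j (g⁻¹ k)))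
    rw [hsw] at this
    simpa [← mul_assoc] using this

end Tableaux

/-! ### Dominance order and tableaux. -/

section Dominance

open Equiv

variable {ι : Type*} [Fintype ι] [DecidableEq ι] {N : ℕ}

/-- The tail sum `∑_{i ≥ k} α i`. -/
def tailSum (α : Fin N → ℕ) (k : Fin N) : ℕ := ∑ i ∈ Finset.Ici k, α i

/-- The sum of all tail sums. -/
def tailWeight (α : Fin N → ℕ) : ℕ := ∑ k, tailSum α k

theorem tailWeight_eq (α : Fin N → ℕ) : tailWeight α = ∑ i : Fin N, ((i : ℕ) + 1) * α i := by
  unfold tailWeight tailSum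
  have h : ∀ k : Fin N, ∑ i ∈ Finset.Ici k, α i = ∑ i : Fin N, if k ≤ i then α i else 0 := by
    intro k
    rw [← Finset.sum_filter]
    congr 1
    ext i; simp
  simp only [h]
  rw [Finset.sum_comm]
  refine Finset.sum_congr rfl fun i _ => ?_
  rw [← Finset.sum_filter, Finset.sum_const, smul_eq_mul]
  congr 1
  have : (Finset.univ.filter fun k : Fin N => k ≤ i) = Finset.Iic i := by ext; simp
  rw [this, Fin.card_Iic]

theorem eq_of_tailSum_eq {α β : Fin N → ℕ} (h : ∀ k, tailSum α k = tailSum β k) : α = β := by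
  funext k
  induction k using WellFoundedGT.induction with
  | ind k ih =>
    have hk := h k
    unfold tailSum at hk
    rw [← Finset.Ioi_insert k, Finset.sum_insert (by simp), Finset.sum_insert (by simp),
      Finset.sum_congr rfl fun j hj => ih j (Finset.mem_Ioi.1 hj)] at hk
    exact Nat.add_right_cancel hk

theorem eq_of_tailWeight_le {α β : Fin N → ℕ} (h : ∀ k, tailSum α k ≤ tailSum β k)
    (hw : tailWeight β ≤ tailWeight α) : α = β := by
  refine eq_of_tailSum_eq fun k => ?_
  have := (Finset.sum_eq_sum_iff_of_le fun k _ => h k).1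
    (le_antisymm (Finset.sum_le_sum fun k _ => h k) hw)
  exact this k (Finset.mem_univ k)

theorem tailSum_wordContent (w : ι → Fin N) (k : Fin N) :
    tailSum (wordContent w) k = (Finset.univ.filter fun i => k ≤ w i).card := by
  unfold tailSum
  rw [Finset.card_eq_sum_card_fiberwise (f := w) (t := Finset.Ici k)]
  · refine Finset.sum_congr rfl fun r hr => ?_
    rw [wordContent_eq_card]
    congr 1
    ext i
    simp only [Finset.mem_filter, Finset.mem_univ, true_and, iff_and_self]
    rintro rfl
    exact Finset.mem_Ici.1 hr
  · intro i hi
    simpa using hi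

/-- A word without repetitions in the columns of a tableau is dominated by the shape. -/
theorem tailSum_le_of_columns {row w : ι → Fin N} {col : ι → ℕ}
    (hfin : ∀ i r, row i < r → ∃ j, col j = col i ∧ row j = r)
    (hw : ∀ i j, col i = col j → w i = w j → i = j) (k : Fin N) :
    tailSum (wordContent w) k ≤ tailSum (wordContent row) k := by
  rw [tailSum_wordContent, tailSum_wordContent]
  rw [Finset.card_eq_sum_card_fiberwise (f := col) (t := Finset.univ.image col)
      (fun i _ => by simp),
    Finset.card_eq_sum_card_fiberwise (s := Finset.univ.filter fun i => k ≤ row i)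
      (f := col) (t := Finset.univ.image col) (fun i _ => by simp)]
  refine Finset.sum_le_sum fun c _ => ?_
  -- Column by column: a column with a cell in a row before `k` meets every row from `k` on, and has
  -- at most that many distinct letters `≥ k`; in any other column all cells lie in rows `≥ k`.
  by_cases h : ∃ i, col i = c ∧ row i < k
  · obtain ⟨i, rfl, hi⟩ := h
    have h1 : (Finset.filter (fun a => col a = col i) (Finset.univ.filter fun a => k ≤ w a)).card ≤
        (Finset.Ici k).card := by
      refine Finset.card_le_card_of_injOn w ?_ ?_
      · intro a ha
        simp only [Finset.coe_filter, Finset.mem_filter, Finset.mem_univ, true_and,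
          Set.mem_ofPred_eq] at ha
        simpa using ha.1
      · intro a ha b hb hab
        simp only [Finset.coe_filter, Finset.mem_filter, Finset.mem_univ, true_and,
          Set.mem_ofPred_eq] at ha hb
        exact hw a b (ha.2.trans hb.2.symm) hab
    refine h1.trans ?_
    have h2 : Finset.Ici k ⊆ (Finset.filter (fun a => col a = col i)
        (Finset.univ.filter fun a => k ≤ row a)).image row := by
      intro r hr
      rw [Finset.mem_Ici] at hr
      obtain ⟨j, hj1, hj2⟩ := hfin i r (lt_of_lt_of_le hi hr)
      rw [Finset.mem_image]
      refine ⟨j, ?_, hj2⟩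
      simp [hj1, hj2, hr]
    exact (Finset.card_le_card h2).trans Finset.card_image_le
  · push Not at h
    refine Finset.card_le_card fun a ha => ?_
    simp only [Finset.mem_filter, Finset.mem_univ, true_and] at ha ⊢
    exact ⟨h a ha.2, ha.2⟩

/-- The row lengths `c i - i` are weakly increasing, written without subtraction. Rows are thus
listed from short to long, which is why dominance is expressed through tail sums. -/
theorem StrictMono.add_val_le {c : Fin N → ℕ} (hc : StrictMono c) {i j : Fin N} (hij : i ≤ j) :
    c i + j ≤ c j + i := by
  obtain ⟨j, hj⟩ := j
  induction j with
  | zero =>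
    have : i = ⟨0, hj⟩ := le_antisymm hij (by simp [Fin.le_def])
    rw [this]
  | succ j ih =>
    rcases hij.eq_or_lt with h | h
    · rw [h]
    · have h1 : i ≤ ⟨j, by omega⟩ := by
        rw [Fin.lt_def] at h
        rw [Fin.le_def]
        simp only at h ⊢
        omega
      have h2 := ih (by omega) h1
      have h3 : c ⟨j, by omega⟩ < c ⟨j + 1, hj⟩ := hc (by simp [Fin.lt_def])
      simp only at h2 ⊢
      omega

theorem StrictMono.val_le {c : Fin N → ℕ} (hc : StrictMono c) (i : Fin N) : (i : ℕ) ≤ c i := by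
  have h := hc.add_val_le (i := ⟨0, i.pos⟩) (j := i) (by simp [Fin.le_def])
  simp only [add_zero] at h
  omega

/-- Every shape has a tableau. -/
theorem exists_tableau {c : Fin N → ℕ} (hc : StrictMono c)
    (hs : ∑ i, c i = Fintype.card ι + ∑ i : Fin N, (i : ℕ)) :
    ∃ (row : ι → Fin N) (col : ι → ℕ),
      (∀ i j, row i = row j → col i = col j → i = j) ∧
      (∀ i r, row i < r → ∃ j, col j = col i ∧ row j = r) ∧
      ∀ i, c i = wordContent row i + i := by
  have hsum : ∑ i, (c i - i) = Fintype.card ι := by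
    have : ∑ i, (c i - i) + ∑ i : Fin N, (i : ℕ) = ∑ i, c i := by
      rw [← Finset.sum_add_distrib]
      exact Finset.sum_congr rfl fun i _ => Nat.sub_add_cancel (hc.val_le i)
    omega
  have e : ι ≃ Σ r : Fin N, Fin (c r - r) := Fintype.equivOfCardEq (by simp [hsum])
  refine ⟨fun i => (e i).1, fun i => ((e i).2 : ℕ), ?_, ?_, ?_⟩
  · intro i j h1 h2
    have hσ : ∀ x y : Σ r : Fin N, Fin (c r - r), x.1 = y.1 → (x.2 : ℕ) = y.2 → x = y := by
      rintro ⟨x1, x2⟩ ⟨y1, y2⟩ h1 h2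
      obtain rfl : x1 = y1 := h1
      rw [Fin.ext (show (x2 : ℕ) = y2 from h2)]
    exact e.injective (hσ _ _ h1 h2)
  · intro i r hr
    change (e i).1 < r at hr
    have h1 := hc.add_val_le hr.le
    have h2 := (e i).2.isLt
    have h3 := hc.val_le (e i).1
    obtain ⟨j, hj⟩ := e.surjective ⟨r, ⟨(e i).2, by omega⟩⟩
    have h4 := congrArg (fun x : Σ r : Fin N, Fin (c r - r) => (x.2 : ℕ)) hj
    exact ⟨j, h4,
      congrArg Sigma.fst hj⟩
  · intro k
    have : {i // (e i).1 = k} ≃ Fin (c k - k) :=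
      (e.subtypeEquiv (fun i => Iff.rfl) :
        {i // (e i).1 = k} ≃ {x : Σ r : Fin N, Fin (c r - r) // x.1 = k}).trans
        (Equiv.sigmaSubtype k)
    unfold wordContent
    rw [Fintype.card_congr this, Fintype.card_fin, Nat.sub_add_cancel (hc.val_le k)]

/-- Rearrangement inequality: the difference of the two sums is half of `∑ (i - σ i) ^ 2`. -/
theorem sum_mul_perm_le (σ : Perm (Fin N)) :
    ∑ i : Fin N, ((i : ℕ) + 1) * (σ i : ℕ) ≤ ∑ i : Fin N, ((i : ℕ) + 1) * (i : ℕ) ∧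
      (∑ i : Fin N, ((i : ℕ) + 1) * (σ i : ℕ) = ∑ i : Fin N, ((i : ℕ) + 1) * (i : ℕ) → σ = 1) := by
  have h1 : ∑ i : Fin N, ((σ i : ℕ) : ℤ) = ∑ i : Fin N, ((i : ℕ) : ℤ) :=
    Equiv.sum_comp σ fun i : Fin N => ((i : ℕ) : ℤ)
  have h2 : ∑ i : Fin N, ((σ i : ℕ) : ℤ) ^ 2 = ∑ i : Fin N, ((i : ℕ) : ℤ) ^ 2 :=
    Equiv.sum_comp σ fun i : Fin N => ((i : ℕ) : ℤ) ^ 2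
  have key : ∑ i : Fin N, (((i : ℕ) : ℤ) - (σ i : ℕ)) ^ 2 =
      2 * ((∑ i : Fin N, ((i : ℕ) + 1) * (i : ℕ) : ℕ) -
        (∑ i : Fin N, ((i : ℕ) + 1) * (σ i : ℕ) : ℕ) : ℤ) := by
    push_cast
    simp only [sub_sq, Finset.sum_add_distrib, Finset.sum_sub_distrib, h2, add_mul, one_mul, h1]
    have : ∑ i : Fin N, 2 * ((i : ℕ) : ℤ) * (σ i : ℕ) = 2 * ∑ i : Fin N, ((i : ℕ) : ℤ) * (σ i : ℕ) := by
      rw [Finset.mul_sum]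
      exact Finset.sum_congr rfl fun i _ => by ring
    have h3 : ∑ i : Fin N, ((i : ℕ) : ℤ) * (i : ℕ) = ∑ i : Fin N, ((i : ℕ) : ℤ) ^ 2 :=
      Finset.sum_congr rfl fun i _ => by ring
    rw [this, h3]
    ring
  have hnn : 0 ≤ ∑ i : Fin N, (((i : ℕ) : ℤ) - (σ i : ℕ)) ^ 2 :=
    Finset.sum_nonneg fun i _ => sq_nonneg _
  refine ⟨by omega, fun h => ?_⟩
  have h0 : ∑ i : Fin N, (((i : ℕ) : ℤ) - (σ i : ℕ)) ^ 2 = 0 := by rw [key, h]; ring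
  rw [Finset.sum_eq_zero_iff_of_nonneg fun i _ => sq_nonneg _] at h0
  ext i
  have := pow_eq_zero_iff (two_ne_zero) |>.1 (h0 i (Finset.mem_univ i))
  simp only [Perm.one_apply]
  omega

end Dominance

/-! ### Positive definiteness of the Jacobi–Trudi characters. -/

section SchurCharPosDef

open Equiv MvPolynomial

variable {ι : Type*} [Fintype ι] [DecidableEq ι] {N : ℕ}

theorem coeffAt_alternant_mul_sum_smul_fixedWords (d : Fin N → ℕ) (f : Perm ι → ℂ) :
    coeffAt d (alternant (fun i : Fin N => (i : ℕ)) * ∑ g, f g • fixedWords (Fin N) g) =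
      ∑ g, f g * schurChar d g := by
  rw [Finset.mul_sum, coeffAt_sum]
  refine Finset.sum_congr rfl fun g _ => ?_
  rw [mul_smul_comm, coeffAt_smul, schurChar]

theorem schurChar_eq_zero {d : Fin N → ℕ}
    (hd : ∑ i, d i ≠ Fintype.card ι + ∑ i : Fin N, (i : ℕ)) (g : Perm ι) : schurChar d g = 0 := by
  unfold schurChar
  rw [coeffAt_alternant_mul]
  refine Finset.sum_eq_zero fun σ _ => ?_
  split_ifs with h
  · rw [coeffAt_fixedWords_eq_zero, mul_zero]
    intro h0
    apply hd
    have h1 : ∑ i, ((σ i : Fin N) : ℕ) = ∑ i : Fin N, (i : ℕ) :=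
      Equiv.sum_comp σ fun i : Fin N => (i : ℕ)
    have h2 : ∑ i, (d - (fun i : Fin N => (i : ℕ)) ∘ σ) i + ∑ i, ((σ i : Fin N) : ℕ) =
        ∑ i, d i := by
      rw [← Finset.sum_add_distrib]
      exact Finset.sum_congr rfl fun i _ => Nat.sub_add_cancel (h i)
    omega
  · rw [mul_zero]

/-- The pairing is the coefficient at `d` of the alternant times the characteristic of `schurChar
c`, that is, of a factorial times `alternant c`. -/
theorem sum_schurChar_mul_schurChar {c d : Fin N → ℕ} (hc : StrictMono c) (hd : StrictMono d)
    (hs : ∑ i, c i = Fintype.card ι + ∑ i : Fin N, (i : ℕ)) :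
    ∑ g : Perm ι, schurChar c g * schurChar d g =
      if c = d then ((Fintype.card ι).factorial : ℂ) else 0 := by
  rw [← coeffAt_alternant_mul_sum_smul_fixedWords, alternant_mul_sum_schurChar hs,
    ← Nat.cast_smul_eq_nsmul ℂ, coeffAt_smul, coeffAt_alternant hc hd]
  simp

/-- The triangularity of Young symmetrizers with respect to the Jacobi–Trudi characters. -/
theorem sum_youngFun_mul_schurChar_triangular {c d : Fin N → ℕ} {row : ι → Fin N} {col : ι → ℕ}
    (hfin : ∀ i r, row i < r → ∃ j, col j = col i ∧ row j = r)
    (hrow : ∀ i, c i = wordContent row i + i) (σ : Perm (Fin N)) (hσ : ∀ i, (σ i : ℕ) ≤ d i)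
    (h : ∑ g, youngFun row col g *
      coeffAt (d - (fun i : Fin N => (i : ℕ)) ∘ σ) (fixedWords (Fin N) g) ≠ 0) :
    tailWeight d ≤ tailWeight c ∧ (tailWeight c ≤ tailWeight d → σ = 1 ∧ d = c) := by
  obtain ⟨w, hw1, hw2⟩ := exists_word_of_coeff_youngFun_ne_zero h
  have hdom := fun k => tailSum_le_of_columns hfin hw2 k
  have hle : tailWeight (wordContent w) ≤ tailWeight (wordContent row) :=
    Finset.sum_le_sum fun k _ => hdom k
  have hd : ∀ i, d i = wordContent w i + σ i := by
    intro i
    rw [hw1]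
    exact (Nat.sub_add_cancel (hσ i)).symm
  have e1 : tailWeight d = tailWeight (wordContent w) + ∑ i : Fin N, ((i : ℕ) + 1) * (σ i : ℕ) := by
    rw [tailWeight_eq, tailWeight_eq, ← Finset.sum_add_distrib]
    exact Finset.sum_congr rfl fun i _ => by rw [hd i]; ring
  have e2 : tailWeight c = tailWeight (wordContent row) + ∑ i : Fin N, ((i : ℕ) + 1) * (i : ℕ) := by
    rw [tailWeight_eq, tailWeight_eq, ← Finset.sum_add_distrib]
    exact Finset.sum_congr rfl fun i _ => by rw [hrow i]; ring
  obtain ⟨h1, h2⟩ := sum_mul_perm_le σ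
  refine ⟨by omega, fun hcd => ?_⟩
  have hσ1 : σ = 1 := h2 (by omega)
  refine ⟨hσ1, ?_⟩
  have hwr : wordContent w = wordContent row := eq_of_tailWeight_le hdom (by omega)
  funext i
  rw [hd i, hrow i, hwr, hσ1]
  rfl

/-- The Jacobi–Trudi characters are positive multiples of averaged Young symmetrizers. -/
theorem exists_schurChar_eq_smul_youngFun (hN : Fintype.card ι ≤ N) (n : ℕ) :
    ∀ c : Fin N → ℕ, StrictMono c → tailWeight c = n →
      ∑ i, c i = Fintype.card ι + ∑ i : Fin N, (i : ℕ) →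
      ∃ (row : ι → Fin N) (col : ι → ℕ) (a : ℂ), 0 < a ∧
        (∀ i r, row i < r → ∃ j, col j = col i ∧ row j = r) ∧
        (∀ i, c i = wordContent row i + i) ∧
        ∀ g, schurChar c g = a * youngFun row col g := by
  induction n using Nat.strong_induction_on with
  | _ n ih =>
    intro c hc hn hs
    obtain ⟨row, col, hinj, hfin, hrow⟩ := exists_tableau (ι := ι) hc hs
    set F := youngFun row col with hF
    have hfac : ((Fintype.card ι).factorial : ℂ) ≠ 0 := by
      exact_mod_cast Nat.factorial_ne_zero _
    set a : ℂ := ((Fintype.card ι).factorial : ℂ)⁻¹ * ∑ g, F g * schurChar c g with ha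
    -- By triangularity only `σ = 1` survives, so the pairing is with a genuine permutation
    -- character; this is what makes `a` nonnegative.
    have hlead : ∑ g, F g * schurChar c g =
        ∑ g, F g * coeffAt (wordContent row) (fixedWords (Fin N) g) := by
      have hexp : ∑ g, F g * schurChar c g = ∑ σ : Perm (Fin N), ((Perm.sign σ : ℤ) : ℂ) *
          if ∀ i, (σ i : ℕ) ≤ c i then ∑ g, F g *
            coeffAt (c - (fun i : Fin N => (i : ℕ)) ∘ σ) (fixedWords (Fin N) g) else 0 := by
        simp only [schurChar, coeffAt_alternant_mul, Finset.mul_sum]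
        rw [Finset.sum_comm]
        refine Finset.sum_congr rfl fun σ _ => ?_
        split_ifs with h
        · rw [Finset.mul_sum]
          exact Finset.sum_congr rfl fun g _ => by ring
        · simp
      rw [hexp, Finset.sum_eq_single 1]
      · have h1 : ∀ i : Fin N, ((1 : Perm (Fin N)) i : ℕ) ≤ c i := hc.val_le
        have h2 : c - (fun i : Fin N => (i : ℕ)) ∘ (1 : Perm (Fin N)) = wordContent row := by
          funext i
          simp [hrow i]
        rw [if_pos h1, h2]
        simp
      · intro σ _ hσ
        split_ifs with h
        · by_contra hne
          exact hσ ((sum_youngFun_mul_schurChar_triangular hfin hrow σ h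
            (right_ne_zero_of_mul hne)).2 le_rfl).1
        · simp
      · simp
    have hcentral : IsCentralFun (F - fun g => a * schurChar c g) := by
      intro g h
      simp only [Pi.sub_apply]
      rw [hF, isCentralFun_youngFun row col g h, isCentralFun_schurChar c g h]
    -- It suffices to pair with every `schurChar d`. The choice of `a` settles `d = c`. Otherwise a
    -- nonzero pairing forces `d` to have smaller tail weight; by induction `schurChar d` is then a
    -- Young symmetrizer, and non-orthogonality in both directions gives mutual dominance, hence `d
    -- = c`.
    have hzero : (F - fun g => a * schurChar c g) = 0 := by
      refine hcentral.eq_zero_of_sum_smul_fixedWords hN ?_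
      refine SymmetricCoeffs.eq_zero
        (SymmetricCoeffs.sum_smul (fun g _ => symmetricCoeffs_fixedWords g) _) fun d hd => ?_
      rw [coeffAt_alternant_mul_sum_smul_fixedWords]
      simp only [Pi.sub_apply, sub_mul, Finset.sum_sub_distrib, mul_assoc]
      rw [← Finset.mul_sum, sum_schurChar_mul_schurChar hc hd hs]
      by_cases hcd : c = d
      · subst hcd
        rw [if_pos rfl, ha]
        field_simp
        ring
      · rw [if_neg hcd, mul_zero, sub_zero]
        by_contra hne
        by_cases hds : ∑ i, d i = Fintype.card ι + ∑ i : Fin N, (i : ℕ)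
        · have hlt : tailWeight d < n := by
            have hex : ∃ σ : Perm (Fin N), ∃ _ : ∀ i, (σ i : ℕ) ≤ d i, ∑ g, F g *
                coeffAt (d - (fun i : Fin N => (i : ℕ)) ∘ σ) (fixedWords (Fin N) g) ≠ 0 := by
              by_contra hcon
              push Not at hcon
              apply hne
              simp only [schurChar, coeffAt_alternant_mul, Finset.mul_sum]
              rw [Finset.sum_comm]
              refine Finset.sum_eq_zero fun σ _ => ?_
              split_ifs with h
              · have := hcon σ h
                simp only [mul_left_comm (F _)]
                rw [← Finset.mul_sum, this, mul_zero]
              · simp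
            obtain ⟨σ, hσ, hσ2⟩ := hex
            obtain ⟨h1, h2⟩ := sum_youngFun_mul_schurChar_triangular hfin hrow σ hσ hσ2
            by_contra hge
            exact hcd (h2 (by omega)).2.symm
          obtain ⟨row', col', b, hb, hfin', hrow', hd'⟩ := ih _ hlt d hd rfl hds
          simp only [hd', mul_left_comm (F _)] at hne
          rw [← Finset.mul_sum] at hne
          have hne' := right_ne_zero_of_mul hne
          have hne'' : ∑ g, youngFun row' col' g * F g ≠ 0 := by
            simpa only [mul_comm] using hne'
          obtain ⟨g, hg⟩ := exists_perm_of_sum_youngFun_mul_ne_zero hne'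
          obtain ⟨g', hg'⟩ := exists_perm_of_sum_youngFun_mul_ne_zero hne''
          have h1 : ∀ k, tailSum (wordContent row') k ≤ tailSum (wordContent row) k := fun k => by
            have := tailSum_le_of_columns (w := row' ∘ g) hfin hg k
            rwa [wordContent_comp_perm] at this
          have h2 : ∀ k, tailSum (wordContent row) k ≤ tailSum (wordContent row') k := fun k => by
            have := tailSum_le_of_columns (w := row ∘ g') hfin' hg' k
            rwa [wordContent_comp_perm] at this
          have h3 := eq_of_tailSum_eq fun k => le_antisymm (h1 k) (h2 k)
          apply hcd
          funext i
          rw [hrow i, hrow' i, h3]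
        · apply hne
          exact Finset.sum_eq_zero fun g _ => by rw [schurChar_eq_zero hds, mul_zero]
    have hFa : ∀ g, F g = a * schurChar c g := fun g => sub_eq_zero.1 (congrFun hzero g)
    have hane : a ≠ 0 := by
      intro h0
      have h1 := hFa 1
      rw [h0, zero_mul, hF, youngFun_one hinj] at h1
      exact hfac h1
    have hann : 0 ≤ a := by
      rw [ha, hlead]
      refine mul_nonneg (inv_nonneg.2 (Nat.cast_nonneg _)) ?_
      exact ((isPosDefFun_youngFun row col).mul
        (isPosDefFun_coeffAt_fixedWords (wordContent row))).sum_nonneg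
    refine ⟨row, col, a⁻¹, inv_pos.2 (lt_of_le_of_ne hann hane.symm), hfin, hrow, fun g => ?_⟩
    rw [← hF, hFa, inv_mul_cancel_left₀ hane]

/-- The Jacobi–Trudi characters are positive definite. -/
theorem isPosDefFun_schurChar (hN : Fintype.card ι ≤ N) {c : Fin N → ℕ} (hc : StrictMono c) :
    IsPosDefFun (schurChar c : Perm ι → ℂ) := by
  by_cases hs : ∑ i, c i = Fintype.card ι + ∑ i : Fin N, (i : ℕ)
  · obtain ⟨row, col, a, ha, -, -, h⟩ := exists_schurChar_eq_smul_youngFun hN _ c hc rfl hs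
    rw [show (schurChar c : Perm ι → ℂ) = fun g => a * youngFun row col g from funext h]
    exact (isPosDefFun_youngFun row col).const_mul ha.le
  · rw [show (schurChar c : Perm ι → ℂ) = fun _ => 0 from funext (schurChar_eq_zero hs)]
    intro n g
    exact Matrix.PosSemidef.zero

end SchurCharPosDef

/-! ### Cycle types in the infinite symmetric group. -/

section CycleTypeSInf

open Equiv

theorem SInf.incl_apply_of_lt {n : ℕ} (g : Perm (Fin n)) (i : Fin n) :
    (SInf.incl n g : Perm ℕ) i = g i :=
  Perm.viaEmbedding_apply g (Fin.valEmbedding : Fin n ↪ ℕ) i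

theorem SInf.incl_apply_of_le {n : ℕ} (g : Perm (Fin n)) {i : ℕ} (hi : n ≤ i) :
    (SInf.incl n g : Perm ℕ) i = i := by
  refine Perm.viaEmbedding_apply_of_notMem g (Fin.valEmbedding : Fin n ↪ ℕ) i ?_
  rintro ⟨x, rfl⟩
  exact absurd x.isLt (not_lt.2 hi)

theorem SInf.exists_incl_eq (x : SInf) : ∃ N, ∀ n, N ≤ n → ∃ g : Perm (Fin n), SInf.incl n g = x := by
  obtain ⟨N, hN⟩ := x.2.bddAbove
  refine ⟨N + 1, fun n hn => ?_⟩
  have hfix : ∀ i, n ≤ i → (x : Perm ℕ) i = i := by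
    intro i hi
    by_contra h
    have := hN h
    omega
  have hlt : ∀ i, (x : Perm ℕ) i < n ↔ i < n := by
    intro i
    constructor
    · intro h
      by_contra hi
      rw [hfix i (not_lt.1 hi)] at h
      exact hi h
    · intro h
      by_contra hi
      have h1 := hfix _ (not_lt.1 hi)
      have := (x : Perm ℕ).injective h1
      omega
  let g : Perm (Fin n) :=
    { toFun := fun i => ⟨(x : Perm ℕ) i, (hlt i).2 i.isLt⟩
      invFun := fun i => ⟨(x : Perm ℕ)⁻¹ i, (hlt _).1 (by simp)⟩
      left_inv := fun i => by simp
      right_inv := fun i => by simp }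
  refine ⟨g, Subtype.ext (Equiv.ext fun i => ?_)⟩
  by_cases hi : i < n
  · exact SInf.incl_apply_of_lt g ⟨i, hi⟩
  · rw [SInf.incl_apply_of_le g (not_lt.1 hi), hfix i (not_lt.1 hi)]

theorem SInf.exists_incl_eq_finite {σ : Type*} [Fintype σ] (x : σ → SInf) :
    ∃ n, ∃ g : σ → Perm (Fin n), ∀ s, SInf.incl n (g s) = x s := by
  choose N hN using fun s => SInf.exists_incl_eq (x s)
  refine ⟨∑ s, N s, ?_⟩
  choose g hg using fun s => hN s (∑ s, N s)
    (Finset.single_le_sum (fun _ _ => Nat.zero_le _) (Finset.mem_univ s))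
  exact ⟨g, hg⟩

theorem SInf.cycleType_eq_of_incl_eq {m n : ℕ} {g : Perm (Fin m)} {h : Perm (Fin n)}
    (e : SInf.incl m g = SInf.incl n h) : g.cycleType = h.cycleType := by
  have key : ∀ {m n : ℕ} (g : Perm (Fin m)) (h : Perm (Fin n)), m ≤ n →
      SInf.incl m g = SInf.incl n h → h.cycleType = g.cycleType := by
    intro m n g h hmn e
    refine cycleType_of_intertwine (Fin.castLE hmn) (Fin.castLE_injective hmn) g h ?_ ?_
    · intro i
      ext
      have h1 := SInf.incl_apply_of_lt g i
      have h2 := SInf.incl_apply_of_lt h (Fin.castLE hmn i)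
      rw [← e] at h2
      simp only [Fin.val_castLE] at h2 ⊢
      rw [← h2, h1]
    · intro k hk
      have hk' : m ≤ k := by
        by_contra hlt
        exact hk ⟨⟨k, not_le.1 hlt⟩, rfl⟩
      ext
      rw [← SInf.incl_apply_of_lt h k, ← e, SInf.incl_apply_of_le g hk']
  rcases le_total m n with hmn | hmn
  · exact (key g h hmn e).symm
  · exact key h g hmn e.symm

/-- The cycle type of a finitely supported permutation. -/
noncomputable def SInf.cycleType (x : SInf) : Multiset ℕ :=
  ((SInf.exists_incl_eq x).choose_spec _ le_rfl).choose.cycleType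

theorem SInf.cycleType_incl {n : ℕ} (g : Perm (Fin n)) :
    SInf.cycleType (SInf.incl n g) = g.cycleType :=
  SInf.cycleType_eq_of_incl_eq
    ((SInf.exists_incl_eq (SInf.incl n g)).choose_spec _ le_rfl).choose_spec

theorem IsCentralFun.exists_eq_cycleType {φ : SInf → ℂ} (hφ : IsCentralFun φ) :
    ∃ Φ : Multiset ℕ → ℂ, φ = fun x => Φ (SInf.cycleType x) := by
  classical
  have h : ∀ x y : SInf, (SInf.cycleType x) = (SInf.cycleType y) → φ x = φ y := by
    intro x y hxy
    obtain ⟨n, g, hg⟩ := SInf.exists_incl_eq_finite ![x, y]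
    have h0 : SInf.incl n (g 0) = x := hg 0
    have h1 : SInf.incl n (g 1) = y := hg 1
    rw [← h0, ← h1, SInf.cycleType_incl, SInf.cycleType_incl] at hxy
    rw [← h0, ← h1]
    exact hφ.eq_of_isConj ((SInf.incl n).map_isConj (Perm.isConj_iff_cycleType_eq.2 hxy))
  refine ⟨fun s => if hs : ∃ x : SInf, (SInf.cycleType x) = s then φ hs.choose else 0, ?_⟩
  funext x
  have hx : ∃ y : SInf, (SInf.cycleType y) = (SInf.cycleType x) := ⟨x, rfl⟩
  simp only [dif_pos hx]
  exact h _ _ hx.choose_spec.symm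

theorem isCentralFun_cycleType_perm {κ : Type*} [Fintype κ] [DecidableEq κ]
    (Φ : Multiset ℕ → ℂ) : IsCentralFun fun g : Perm κ => Φ g.cycleType :=
  isCentralFun_of_conj fun g h => by rw [Perm.cycleType_conj]

theorem isCentralFun_cycleType (Φ : Multiset ℕ → ℂ) :
    IsCentralFun fun x : SInf => Φ (SInf.cycleType x) := by
  intro x y
  obtain ⟨n, g, hg⟩ := SInf.exists_incl_eq_finite ![x, y]
  have h0 : SInf.incl n (g 0) = x := hg 0
  have h1 : SInf.incl n (g 1) = y := hg 1
  rw [← h0, ← h1, ← map_mul, ← map_mul]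
  simp only [SInf.cycleType_incl]
  exact isCentralFun_cycleType_perm Φ (g 0) (g 1)

theorem IsPosDefFun.cycleType_perm {Φ : Multiset ℕ → ℂ}
    (h : IsPosDefFun fun x : SInf => Φ (SInf.cycleType x)) (κ : Type*) [Fintype κ] [DecidableEq κ] :
    IsPosDefFun fun g : Perm κ => Φ g.cycleType := by
  have h1 := h.comp_hom ((SInf.incl (Fintype.card κ)).comp
    (Equiv.permCongrHom (Fintype.equivFin κ)).toMonoidHom)
  convert h1 using 1
  funext g
  refine congrArg Φ ?_
  change g.cycleType = SInf.cycleType (SInf.incl _ ((Fintype.equivFin κ).permCongr g))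
  rw [SInf.cycleType_incl, cycleType_permCongr]

theorem isPosDefFun_cycleType {Φ : Multiset ℕ → ℂ}
    (h : ∀ n, IsPosDefFun fun g : Perm (Fin n) => Φ g.cycleType) :
    IsPosDefFun fun x : SInf => Φ (SInf.cycleType x) := by
  intro k x
  obtain ⟨n, g, hg⟩ := SInf.exists_incl_eq_finite x
  convert h n k g using 4 with i j
  rw [← hg, ← hg, ← map_inv, ← map_mul]
  simp only [SInf.cycleType_incl]

theorem SInf.cycleType_one : SInf.cycleType 1 = 0 := by
  rw [← map_one (SInf.incl 0), SInf.cycleType_incl, Perm.cycleType_one]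

end CycleTypeSInf

/-! ### Indecomposability and multiplicativity. -/

section Multiplicativity

open Equiv

/-- Multiplicativity of a function of the cycle type. -/
def IsMultiplicativeOnCycleTypes (Φ : Multiset ℕ → ℂ) : Prop :=
  ∀ (m n : ℕ) (g : Perm (Fin m)) (h : Perm (Fin n)),
    Φ (g.cycleType + h.cycleType) = Φ g.cycleType * Φ h.cycleType

/-- Conjugate by `(1 + ε g) / 2` with `g` disjoint from `x`. The two diagonal terms give `Φ` of `x`,
and the two mixed ones agree because inverses have the same cycle type. -/
theorem isPosDefFun_add_disjoint {Φ : Multiset ℕ → ℂ}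
    (hΦ : IsPosDefFun fun x : SInf => Φ (SInf.cycleType x)) {m : ℕ} (g : Perm (Fin m)) {ε : ℂ}
    (hε : star ε = ε) (hε2 : ε * ε = 1) :
    IsPosDefFun fun x : SInf =>
      1 / 2 * (Φ (SInf.cycleType x) + ε * Φ (g.cycleType + (SInf.cycleType x))) := by
  refine isPosDefFun_cycleType (Φ := fun s => 1 / 2 * (Φ s + ε * Φ (g.cycleType + s))) fun n => ?_
  have h := ((hΦ.cycleType_perm (Fin m ⊕ Fin n)).sandwich
    ((Perm.sumCongrHom (Fin m) (Fin n)).comp (MonoidHom.inr _ _))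
    ![1, Perm.sumCongr g 1] ![1, ε]).const_mul (a := 1 / 4) (by norm_num [Complex.le_def])
  convert h using 2 with x
  have e : ∀ x : Perm (Fin n), ((Perm.sumCongrHom (Fin m) (Fin n)).comp (MonoidHom.inr _ _)) x =
    Perm.sumCongr 1 x := fun x => rfl
  simp only [Fin.sum_univ_two, e, Matrix.cons_val_zero, Matrix.cons_val_one, Perm.sumCongr_mul,
    Perm.sumCongr_inv, one_mul, mul_one, inv_one, mul_inv_cancel, star_one, cycleType_sumCongr,
    Perm.cycleType_one, Perm.cycleType_inv, zero_add, hε]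
  linear_combination (-1 / 4 * Φ x.cycleType) * hε2

/-- Linear dependence of the halves for `ε = ±1` gives a relation `(s + t) Φ(x) + (s - t) Φ(g x) =
0`. Its value at `x = 1` excludes `s = t` and identifies the ratio as `Φ(g)`. -/
theorem IsGroupCharacter.isMultiplicativeOnCycleTypes {Φ : Multiset ℕ → ℂ}
    (hφ : IsGroupCharacter fun x : SInf => Φ (SInf.cycleType x)) : IsMultiplicativeOnCycleTypes Φ := by
  intro m n g h
  have h1 : Φ 0 = 1 := by
    have := hφ.normalized
    rwa [SInf.cycleType_one] at this
  have hdep := hφ.indecomposable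
    (fun x => 1 / 2 * (Φ (SInf.cycleType x) + 1 * Φ (g.cycleType + SInf.cycleType x)))
    (fun x => 1 / 2 * (Φ (SInf.cycleType x) + (-1) * Φ (g.cycleType + SInf.cycleType x)))
    (isCentralFun_cycleType fun s => 1 / 2 * (Φ s + 1 * Φ (g.cycleType + s)))
    (isPosDefFun_add_disjoint hφ.posDef g (ε := 1) (by simp) (by simp))
    (isCentralFun_cycleType fun s => 1 / 2 * (Φ s + (-1) * Φ (g.cycleType + s)))
    (isPosDefFun_add_disjoint hφ.posDef g (ε := -1) (by simp) (by simp))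
    (by funext x; simp only [Pi.add_apply]; ring)
  rw [LinearIndependent.pair_iff] at hdep
  push Not at hdep
  obtain ⟨s, t, hst, hne⟩ := hdep
  have key : ∀ x : SInf, (s + t) * Φ (SInf.cycleType x) + (s - t) * Φ (g.cycleType + (SInf.cycleType x)) = 0 := by
    intro x
    have := congrFun hst x
    simp only [Pi.add_apply, Pi.smul_apply, smul_eq_mul, Pi.zero_apply] at this
    linear_combination 2 * this
  have hx := key 1
  rw [SInf.cycleType_one, add_zero, h1] at hx
  have hst' : s - t ≠ 0 := by
    intro h0
    rw [h0] at hx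
    have hs : s = 0 := by linear_combination (1 / 2) * hx + (1 / 2) * h0
    exact hne hs (by linear_combination hs - h0)
  have hy := key (SInf.incl n h)
  rw [SInf.cycleType_incl] at hy
  apply mul_left_cancel₀ hst'
  linear_combination hy - Φ h.cycleType * hx

/-- The permutation `g` acting on the `i`-th of `N` disjoint copies. -/
def copyPerm {m N : ℕ} (g : Perm (Fin m)) (i : Fin N) : Perm (Σ _ : Fin N, Fin m) :=
  Perm.sigmaCongrRight fun k => if k = i then g else 1

theorem cycleType_copyPerm {m N : ℕ} (g : Perm (Fin m)) (i : Fin N) :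
    (copyPerm g i).cycleType = g.cycleType := by
  rw [copyPerm, cycleType_sigmaCongrRight, Finset.sum_eq_single i]
  · rw [if_pos rfl]
  · intro j _ hj
    rw [if_neg hj, Perm.cycleType_one]
  · simp

theorem cycleType_copyPerm_mul_inv {m N : ℕ} (g : Perm (Fin m)) (i j : Fin N) :
    (copyPerm g i * (copyPerm g j)⁻¹).cycleType =
      if i = j then 0 else g.cycleType + g.cycleType := by
  split_ifs with hij
  · rw [hij, mul_inv_cancel, Perm.cycleType_one]
  · have hd : Perm.Disjoint (copyPerm g i) (copyPerm g j)⁻¹ := by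
      rw [Perm.disjoint_inv_right_iff]
      rintro ⟨k, x⟩
      by_cases hk : k = i
      · right
        simp [copyPerm, hk, hij]
      · left
        simp [copyPerm, hk]
    rw [hd.cycleType_mul, Perm.cycleType_inv, cycleType_copyPerm, cycleType_copyPerm]

/-- Positive definiteness at the identity with weight `N * z` and at `N` disjoint copies of `g` with
weight `1`. As `N` grows, the diagonal correction becomes negligible against the quadratic in `z`.
-/
theorem quadratic_form_of_disjoint_copies {Φ : Multiset ℕ → ℂ}
    (hΦ : IsPosDefFun fun x : SInf => Φ (SInf.cycleType x)) {m : ℕ} (g : Perm (Fin m)) (N : ℕ) (z : ℝ) :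
    0 ≤ (N : ℂ) * (N * (z ^ 2 * Φ 0 + 2 * z * Φ g.cycleType + Φ (g.cycleType + g.cycleType)) +
      (Φ 0 - Φ (g.cycleType + g.cycleType))) := by
  let a : Option (Fin N) → Perm (Σ _ : Fin N, Fin m) := fun o => o.elim 1 fun i =>
    copyPerm g i
  let b : Option (Fin N) → ℂ := fun o => o.elim (N * z) fun _ => 1
  have h := (hΦ.cycleType_perm (Σ _ : Fin N, Fin m)).quadratic_nonneg a b
  have e0 : ∀ i : Fin N, (a (some i)).cycleType = g.cycleType := cycleType_copyPerm g
  have e1 : ∀ i j : Fin N, (a (some i) * (a (some j))⁻¹).cycleType =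
      if i = j then 0 else g.cycleType + g.cycleType := cycleType_copyPerm_mul_inv g
  have a0 : a none = 1 := rfl
  have b0 : b none = N * z := rfl
  have b1 : ∀ i, b (some i) = 1 := fun _ => rfl
  simp only [Fintype.sum_option, a0, b0, b1, one_mul, inv_one, mul_one, Perm.cycleType_one,
    Perm.cycleType_inv, e0, e1, apply_ite Φ, star_one, Finset.sum_const, Finset.card_univ,
    Fintype.card_fin, nsmul_eq_mul, Finset.sum_add_distrib] at h
  have h3 : ∀ i : Fin N, ∑ j : Fin N, (if i = j then Φ 0 else Φ (g.cycleType + g.cycleType)) =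
      Φ 0 + (N - 1) * Φ (g.cycleType + g.cycleType) := by
    intro i
    have : ∀ j : Fin N, (if i = j then Φ 0 else Φ (g.cycleType + g.cycleType)) =
        Φ (g.cycleType + g.cycleType) +
          if i = j then Φ 0 - Φ (g.cycleType + g.cycleType) else 0 := by
      intro j; split_ifs <;> ring
    simp only [this, Finset.sum_add_distrib, Finset.sum_ite_eq, Finset.mem_univ, if_true]
    simp
    ring
  simp only [h3, Finset.sum_const, Finset.card_univ, Fintype.card_fin, nsmul_eq_mul] at h
  convert h using 1
  simp
  ring

theorem star_eq_of_isPosDefFun {Φ : Multiset ℕ → ℂ}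
    (hΦ : IsPosDefFun fun x : SInf => Φ (SInf.cycleType x)) {m : ℕ} (g : Perm (Fin m)) :
    star (Φ g.cycleType) = Φ g.cycleType := by
  have := (hΦ.cycleType_perm (Fin m)).map_inv g
  simpa using this.symm

theorem exists_real_quadratic {Φ : Multiset ℕ → ℂ}
    (hΦ : IsPosDefFun fun x : SInf => Φ (SInf.cycleType x)) {m : ℕ} (g : Perm (Fin m)) :
    ∃ b s t : ℝ, Φ 0 = b ∧ Φ g.cycleType = s ∧ Φ (g.cycleType + g.cycleType) = t ∧
      ∀ z : ℝ, 0 ≤ z ^ 2 * b + 2 * z * s + t := by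
  have real : ∀ {m : ℕ} (g : Perm (Fin m)), ∃ r : ℝ, Φ g.cycleType = r := fun g =>
    ⟨_, (Complex.conj_eq_iff_re.1 (star_eq_of_isPosDefFun hΦ g)).symm⟩
  obtain ⟨b, hb⟩ := real (1 : Perm (Fin 0))
  obtain ⟨s, hs⟩ := real g
  obtain ⟨t, ht⟩ := real (finSumFinEquiv.permCongr (Perm.sumCongr g g))
  rw [Perm.cycleType_one] at hb
  rw [cycleType_permCongr, cycleType_sumCongr] at ht
  refine ⟨b, s, t, hb, hs, ht, fun z => ?_⟩
  have h : ∀ N : ℕ, 0 < N → 0 ≤ N * (z ^ 2 * b + 2 * z * s + t) + (b - t) := by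
    intro N hN
    have h1 := quadratic_form_of_disjoint_copies hΦ g N z
    rw [hb, hs, ht] at h1
    have h2 : (0 : ℝ) ≤ N * (N * (z ^ 2 * b + 2 * z * s + t) + (b - t)) := by
      exact_mod_cast h1
    exact nonneg_of_mul_nonneg_right h2 (by exact_mod_cast hN)
  by_contra hneg
  push Not at hneg
  obtain ⟨N, hN⟩ := exists_nat_gt ((b - t) / -(z ^ 2 * b + 2 * z * s + t))
  have hp : 0 < -(z ^ 2 * b + 2 * z * s + t) := by linarith
  have h1 := h (N + 1) (Nat.succ_pos N)
  rw [div_lt_iff₀ hp] at hN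
  push_cast at h1
  linarith

/-- The two nonnegative quadratics add up to `(z + x) ^ 2` with `x = s₁ + s₂`. Both vanish at `-x`,
so each is a multiple of this square. -/
theorem proportional_of_dominated {b₁ s₁ t₁ b₂ s₂ t₂ : ℝ} (hb : b₁ + b₂ = 1)
    (ht : t₁ + t₂ = (s₁ + s₂) ^ 2) (h₁ : ∀ z : ℝ, 0 ≤ z ^ 2 * b₁ + 2 * z * s₁ + t₁)
    (h₂ : ∀ z : ℝ, 0 ≤ z ^ 2 * b₂ + 2 * z * s₂ + t₂) (hb₂ : 0 ≤ b₂) :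
    s₁ = b₁ * (s₁ + s₂) := by
  set x := s₁ + s₂ with hx
  have hs₂ : s₂ = x - s₁ := by rw [hx]; ring
  have hb₂' : b₂ = 1 - b₁ := by linarith
  have ht₂ : t₂ = x ^ 2 - t₁ := by linarith
  have e1 := h₁ (-x)
  have e2 := h₂ (-x)
  rw [hs₂, hb₂', ht₂] at e2
  have e0 : x ^ 2 * b₁ - 2 * x * s₁ + t₁ = 0 := by nlinarith
  -- Moving off the zero `-x` by `u = s₁ - b₁ * x`, against the slope, gives the value `u ^ 2 * (b₁
  -- - 2)`; since `b₁ ≤ 1`, nonnegativity forces `u = 0`.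
  have e3 := h₁ (-x - (s₁ - b₁ * x))
  have e4 : 0 ≤ (s₁ - b₁ * x) ^ 2 * (b₁ - 2) := by nlinarith
  have e5 : (s₁ - b₁ * x) ^ 2 ≤ 0 := by nlinarith [sq_nonneg (s₁ - b₁ * x)]
  have e6 : s₁ - b₁ * x = 0 := by
    have := le_antisymm e5 (sq_nonneg _)
    exact pow_eq_zero_iff two_ne_zero |>.1 this
  linarith

theorem IsMultiplicativeOnCycleTypes.isGroupCharacter {Φ : Multiset ℕ → ℂ}
    (hmul : IsMultiplicativeOnCycleTypes Φ) (h0 : Φ 0 = 1)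
    (hpos : IsPosDefFun fun x : SInf => Φ (SInf.cycleType x)) :
    IsGroupCharacter fun x : SInf => Φ (SInf.cycleType x) where
  central := isCentralFun_cycleType Φ
  posDef := hpos
  normalized := by rw [SInf.cycleType_one, h0]
  indecomposable := by
    intro φ₁ φ₂ hc₁ hp₁ hc₂ hp₂ hsum hli
    obtain ⟨Φ₁, rfl⟩ := hc₁.exists_eq_cycleType
    obtain ⟨Φ₂, rfl⟩ := hc₂.exists_eq_cycleType
    have hadd : ∀ {n : ℕ} (g : Perm (Fin n)),
        Φ g.cycleType = Φ₁ g.cycleType + Φ₂ g.cycleType := by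
      intro n g
      have := congrFun hsum (SInf.incl n g)
      simpa only [Pi.add_apply, SInf.cycleType_incl] using this
    have hadd0 : Φ₁ 0 + Φ₂ 0 = 1 := by
      have := hadd (1 : Perm (Fin 0))
      rw [Perm.cycleType_one, h0] at this
      exact this.symm
    have hprop : ∀ x : SInf, Φ₁ (SInf.cycleType x) = Φ₁ 0 * Φ (SInf.cycleType x) ∧
        Φ₂ (SInf.cycleType x) = Φ₂ 0 * Φ (SInf.cycleType x) := by
      intro x
      obtain ⟨n, g, hg⟩ := SInf.exists_incl_eq_finite fun _ : Unit => x
      rw [← hg (), SInf.cycleType_incl]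
      generalize g () = g
      obtain ⟨b₁, s₁, t₁, hb₁, hs₁, ht₁, hq₁⟩ := exists_real_quadratic hp₁ g
      obtain ⟨b₂, s₂, t₂, hb₂, hs₂, ht₂, hq₂⟩ := exists_real_quadratic hp₂ g
      have hb : b₁ + b₂ = 1 := by
        have := hadd0
        rw [hb₁, hb₂] at this
        exact_mod_cast this
      have hs : Φ g.cycleType = ((s₁ + s₂ : ℝ) : ℂ) := by
        rw [hadd, hs₁, hs₂]; push_cast; ring
      have ht : t₁ + t₂ = (s₁ + s₂) ^ 2 := by
        have h1 := hadd (finSumFinEquiv.permCongr (Perm.sumCongr g g))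
        rw [cycleType_permCongr, cycleType_sumCongr, hmul, hs, ht₁, ht₂] at h1
        have : ((t₁ + t₂ : ℝ) : ℂ) = (((s₁ + s₂) ^ 2 : ℝ) : ℂ) := by
          push_cast at h1 ⊢
          linear_combination -h1
        exact_mod_cast this
      have nn : ∀ {Ψ : Multiset ℕ → ℂ} {b : ℝ}, (IsPosDefFun fun x : SInf => Ψ (SInf.cycleType x)) →
          Ψ 0 = b → 0 ≤ b := by
        intro Ψ b h hb
        have := h.one_nonneg
        rw [SInf.cycleType_one, hb] at this
        exact_mod_cast this
      have p₁ := proportional_of_dominated hb ht hq₁ hq₂ (nn hp₂ hb₂)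
      have p₂ := proportional_of_dominated (by linarith) (by rw [add_comm, ht, add_comm s₁])
        hq₂ hq₁ (nn hp₁ hb₁)
      rw [hs₁, hs₂, hb₁, hb₂, hs]
      refine ⟨?_, ?_⟩
      · exact_mod_cast p₁
      · rw [add_comm s₁]
        exact_mod_cast p₂
    rw [LinearIndependent.pair_iff] at hli
    -- Both summands are multiples of `Φ`, by their values at the identity. Independence would make
    -- both values vanish, although they add up to `1`.
    obtain ⟨h1, h2⟩ := hli (Φ₂ 0) (-Φ₁ 0) (by
      funext x
      simp only [Pi.add_apply, Pi.smul_apply, smul_eq_mul, Pi.zero_apply]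
      rw [(hprop x).1, (hprop x).2]
      ring)
    rw [neg_eq_zero] at h2
    rw [h1, h2] at hadd0
    norm_num at hadd0

end Multiplicativity

/-! ### Toeplitz minors of the one-row coefficients. -/

section ToeplitzMinors

open Equiv MvPolynomial

variable {ι ι' κ : Type*} [Fintype ι] [DecidableEq ι] [Fintype ι'] [DecidableEq ι'] [Fintype κ]
  [DecidableEq κ] {N : ℕ}

/-- The Toeplitz matrix of a complex sequence. -/
def complexToeplitz (a : ℕ → ℂ) (i j : ℕ) : ℂ := if i ≤ j then a (j - i) else 0

/-- The signed expansion of the alternant matches the Leibniz formula term by term; the zeros below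
the diagonal of the Toeplitz matrix account for exponents that would be negative. -/
theorem coeffAt_alternant_mul_eq_det {a : ℕ → ℂ} {P : MvPolynomial (Fin N) ℂ} {n : ℕ} {C : ℂ}
    (hP : ∀ α : Fin N → ℕ, ∑ i, α i = n → coeffAt α P = C * ∏ i, a (α i)) {r c : Fin N → ℕ}
    (hs : ∑ i, c i = ∑ i, r i + n) :
    coeffAt c (alternant r * P) =
      C * (Matrix.of fun i j => complexToeplitz a (r i) (c j)).det := by
  rw [coeffAt_alternant_mul, Matrix.det_apply', Finset.mul_sum]
  refine Finset.sum_congr rfl fun σ _ => ?_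
  rw [mul_left_comm]
  congr 1
  split_ifs with h
  · rw [hP]
    · congr 1
      refine Finset.prod_congr rfl fun i _ => ?_
      simp [complexToeplitz, h i]
    · have h1 : ∑ i, r (σ i) = ∑ i, r i := Equiv.sum_comp σ r
      have h2 : ∑ i, (c - r ∘ σ) i + ∑ i, r (σ i) = ∑ i, c i := by
        rw [← Finset.sum_add_distrib]
        exact Finset.sum_congr rfl fun i _ => Nat.sub_add_cancel (h i)
      omega
  · rw [not_forall] at h
    obtain ⟨i, hi⟩ := h
    rw [Finset.prod_eq_zero (Finset.mem_univ i), mul_zero]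
    simp only [Matrix.of_apply, complexToeplitz, if_neg hi]

theorem wordContent_sumElim (w : ι → κ) (v : ι' → κ) :
    wordContent (Sum.elim w v) = wordContent w + wordContent v := by
  funext k
  simp only [wordContent_eq_card, Pi.add_apply, Finset.card_filter, Fintype.sum_sum_type,
    Sum.elim_inl, Sum.elim_inr]
  rfl

theorem fixedWords_sumCongr (g : Perm ι) (h : Perm ι') :
    fixedWords κ (Perm.sumCongr g h) = fixedWords κ g * fixedWords κ h := by
  unfold fixedWords
  simp only [Finset.sum_filter]
  rw [Finset.sum_mul_sum, ← Equiv.sum_comp (Equiv.sumArrowEquivProdArrow ι ι' κ).symm,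
    Fintype.sum_prod_type]
  refine Finset.sum_congr rfl fun w _ => Finset.sum_congr rfl fun v _ => ?_
  change (if ∀ i, Sum.elim w v (Perm.sumCongr g h i) = Sum.elim w v i then
    mono (wordContent (Sum.elim w v)) else 0) = _
  rw [wordContent_sumElim, mono_add]
  by_cases hw : ∀ i, w (g i) = w i <;> by_cases hv : ∀ i, v (h i) = v i <;>
    simp [Sum.forall, hw, hv]

/-- The normalized sums over the symmetric groups of a function of the cycle type. -/
noncomputable def symmetricMean (Φ : Multiset ℕ → ℂ) (n : ℕ) : ℂ :=
  ((n.factorial : ℂ))⁻¹ * ∑ g : Perm (Fin n), Φ g.cycleType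

theorem oneRowCoeff_cycleType (Φ : Multiset ℕ → ℂ) (n : ℕ) :
    oneRowCoeff (fun x => Φ (SInf.cycleType x)) n = symmetricMean Φ n := by
  simp [oneRowCoeff, permInner, symmetricMean, SInf.cycleType_incl]

theorem IsMultiplicativeOnCycleTypes.stabSum_eq {Φ : Multiset ℕ → ℂ}
    (hΦ : IsMultiplicativeOnCycleTypes Φ) (h0 : Φ 0 = 1) (w : ι → κ) :
    stabSum (fun g => Φ g.cycleType) w =
      (∏ k, ((wordContent w k).factorial : ℂ)) * ∏ k, symmetricMean Φ (wordContent w k) := by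
  rw [stabSum_multiplicative Φ h0 hΦ, ← Finset.prod_mul_distrib]
  refine Finset.prod_congr rfl fun k _ => ?_
  rw [symmetricMean, mul_inv_cancel_left₀ (by exact_mod_cast Nat.factorial_ne_zero _)]
  rfl

/-- The number of words of content `α` is a multinomial coefficient, whose denominators cancel the
factorials of the Young subgroup sum. -/
theorem IsMultiplicativeOnCycleTypes.coeffAt_eq {Φ : Multiset ℕ → ℂ}
    (hΦ : IsMultiplicativeOnCycleTypes Φ) (h0 : Φ 0 = 1) (α : κ → ℕ)
    (hα : ∑ k, α k = Fintype.card ι) :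
    coeffAt α (∑ g : Perm ι, Φ g.cycleType • fixedWords κ g) =
      (Fintype.card ι).factorial * ∏ k, symmetricMean Φ (α k) := by
  obtain ⟨w, rfl⟩ := exists_word_of_sum_eq (ι := ι) α hα
  rw [coeffAt_sum_smul_fixedWords (isCentralFun_cycleType_perm Φ), hΦ.stabSum_eq h0, ← mul_assoc,
    card_words_mul_prod_factorial]

/-- Up to `m! * n!`, the minor is the sum over `S(m) × S(n)` of `χ_r(g) Φ(h) χ_c(g ⊕ h)`, a product
of three positive definite functions. The bound on `∑ c i` says `m + n ≤ N`, so there are enough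
variables for `schurChar c` to be positive definite. -/
theorem det_symmetricMean_nonneg_of_le {Φ : Multiset ℕ → ℂ}
    (hΦ : IsMultiplicativeOnCycleTypes Φ) (h0 : Φ 0 = 1)
    (hpos : IsPosDefFun fun x : SInf => Φ (SInf.cycleType x)) {r c : Fin N → ℕ}
    (hr : StrictMono r) (hc : StrictMono c) (hrc : ∑ i, r i ≤ ∑ i, c i)
    (hN : ∑ i, c i ≤ N + ∑ i : Fin N, (i : ℕ)) :
    0 ≤ (Matrix.of fun i j => complexToeplitz (symmetricMean Φ) (r i) (c j)).det := by
  have hδ : ∑ i : Fin N, (i : ℕ) ≤ ∑ i, r i := Finset.sum_le_sum fun i _ => hr.val_le i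
  obtain ⟨m, hm⟩ := Nat.exists_eq_add_of_le' hδ
  obtain ⟨n, hn⟩ := Nat.exists_eq_add_of_le hrc
  have hcard : Fintype.card (Fin m ⊕ Fin n) ≤ N := by
    simp only [Fintype.card_sum, Fintype.card_fin]
    omega
  have hpd : IsPosDefFun fun p : Perm (Fin m) × Perm (Fin n) =>
      schurChar r p.1 * Φ p.2.cycleType * schurChar c (Perm.sumCongr p.1 p.2) := by
    have hm' : Fintype.card (Fin m) ≤ N := by
      rw [Fintype.card_fin]
      omega
    have p1 : IsPosDefFun fun p : Perm (Fin m) × Perm (Fin n) => schurChar r p.1 :=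
      (isPosDefFun_schurChar (ι := Fin m) hm' hr).comp_hom
        (MonoidHom.fst (Perm (Fin m)) (Perm (Fin n)))
    have p2 : IsPosDefFun fun p : Perm (Fin m) × Perm (Fin n) => Φ p.2.cycleType :=
      (hpos.cycleType_perm (Fin n)).comp_hom (MonoidHom.snd (Perm (Fin m)) (Perm (Fin n)))
    have p3 : IsPosDefFun fun p : Perm (Fin m) × Perm (Fin n) =>
        schurChar c (Perm.sumCongr p.1 p.2) :=
      (isPosDefFun_schurChar (ι := Fin m ⊕ Fin n) hcard hc).comp_hom
        (Perm.sumCongrHom (Fin m) (Fin n))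
    exact (p1.mul p2).mul p3
  have hsum := hpd.sum_nonneg
  rw [Fintype.sum_prod_type] at hsum
  have hval : ∑ g : Perm (Fin m), ∑ h : Perm (Fin n),
      schurChar r g * Φ h.cycleType * schurChar c (Perm.sumCongr g h) =
        (m.factorial * n.factorial : ℂ) *
          (Matrix.of fun i j => complexToeplitz (symmetricMean Φ) (r i) (c j)).det := by
    have h1 : coeffAt c ((alternant (fun i : Fin N => (i : ℕ)) *
        ∑ g : Perm (Fin m), schurChar r g • fixedWords (Fin N) g) *
          ∑ h : Perm (Fin n), Φ h.cycleType • fixedWords (Fin N) h) =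
        ∑ g : Perm (Fin m), ∑ h : Perm (Fin n),
          schurChar r g * Φ h.cycleType * schurChar c (Perm.sumCongr g h) := by
      rw [mul_assoc, Finset.sum_mul_sum, Finset.mul_sum, coeffAt_sum]
      refine Finset.sum_congr rfl fun g _ => ?_
      rw [Finset.mul_sum, coeffAt_sum]
      refine Finset.sum_congr rfl fun h _ => ?_
      rw [smul_mul_smul_comm, ← fixedWords_sumCongr, mul_smul_comm, coeffAt_smul]
      rfl
    rw [← h1, alternant_mul_sum_schurChar (by simpa using hm), ← Nat.cast_smul_eq_nsmul ℂ,
      smul_mul_assoc, coeffAt_smul, mul_assoc, Fintype.card_fin]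
    congr 1
    refine coeffAt_alternant_mul_eq_det (n := n) (fun α hα => ?_) hn
    rw [hΦ.coeffAt_eq h0 α (by simpa using hα), Fintype.card_fin]
  simp only at hsum
  rw [hval] at hsum
  have hfac : (0 : ℂ) < m.factorial * n.factorial := by
    exact_mod_cast Nat.mul_pos (Nat.factorial_pos m) (Nat.factorial_pos n)
  have h3 := mul_nonneg (inv_nonneg.2 hfac.le) hsum
  rwa [inv_mul_cancel_left₀ hfac.ne'] at h3

theorem det_complexToeplitz_eq_zero {a : ℕ → ℂ} {r c : Fin N → ℕ}
    (h : ∑ i, c i < ∑ i, r i) :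
    (Matrix.of fun i j => complexToeplitz a (r i) (c j)).det = 0 := by
  rw [Matrix.det_apply']
  refine Finset.sum_eq_zero fun σ _ => ?_
  have hex : ∃ i, c i < r (σ i) := by
    by_contra hcon
    push Not at hcon
    have h1 : ∑ i, r (σ i) = ∑ i, r i := Equiv.sum_comp σ r
    have h2 : ∑ i, r (σ i) ≤ ∑ i, c i := Finset.sum_le_sum fun i _ => hcon i
    omega
  obtain ⟨i, hi⟩ := hex
  rw [Finset.prod_eq_zero (Finset.mem_univ i), mul_zero]
  simp only [Matrix.of_apply, complexToeplitz, if_neg (not_le.2 hi)]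

/-- The new first column is `(1, 0, …, 0)`, and shifting rows and columns together does not change a
Toeplitz entry. -/
theorem det_complexToeplitz_cons {a : ℕ → ℂ} (ha : a 0 = 1) (r c : Fin N → ℕ) :
    (Matrix.of fun i j => complexToeplitz a
      ((Fin.cons 0 fun k => r k + 1 : Fin (N + 1) → ℕ) i)
      ((Fin.cons 0 fun k => c k + 1 : Fin (N + 1) → ℕ) j)).det =
    (Matrix.of fun i j => complexToeplitz a (r i) (c j)).det := by
  rw [Matrix.det_succ_column_zero, Fin.sum_univ_succ, Finset.sum_eq_zero]
  · have h1 : complexToeplitz a 0 0 = 1 := by simp [complexToeplitz, ha]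
    simp only [Fin.val_zero, pow_zero, one_mul, Matrix.of_apply, Fin.cons_zero, h1, add_zero]
    congr 1
    ext i j
    simp [complexToeplitz]
  · intro i _
    simp [complexToeplitz]

theorem strictMono_cons_zero_succ {r : Fin N → ℕ} (hr : StrictMono r) :
    StrictMono (Fin.cons 0 fun k => r k + 1 : Fin (N + 1) → ℕ) := by
  intro i j
  refine Fin.cases ?_ (fun i => ?_) i <;> refine Fin.cases ?_ (fun j => ?_) j
  · intro h; exact absurd h (lt_irrefl _)
  · intro _; simp
  · intro h; exact absurd h (by simp)
  · intro h
    simpa using hr (Fin.succ_lt_succ_iff.1 h)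

theorem symmetricMean_zero {Φ : Multiset ℕ → ℂ} (h0 : Φ 0 = 1) : symmetricMean Φ 0 = 1 := by
  have : ∀ g : Perm (Fin 0), g = 1 := fun g => Subsingleton.elim _ _
  simp [symmetricMean, h0]

/-- The Toeplitz minors of the one-row coefficients of a character are nonnegative. -/
theorem det_symmetricMean_nonneg {Φ : Multiset ℕ → ℂ}
    (hΦ : IsMultiplicativeOnCycleTypes Φ) (h0 : Φ 0 = 1)
    (hpos : IsPosDefFun fun x : SInf => Φ (SInf.cycleType x)) {r c : Fin N → ℕ}
    (hr : StrictMono r) (hc : StrictMono c) :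
    0 ≤ (Matrix.of fun i j => complexToeplitz (symmetricMean Φ) (r i) (c j)).det := by
  -- Prepending a row and a column raises `N` by one and preserves `∑ c i - ∑ i`. After `t` such
  -- steps the bound on the number of variables holds.
  have key : ∀ (t N : ℕ) (r c : Fin N → ℕ), StrictMono r → StrictMono c →
      ∑ i, r i ≤ ∑ i, c i → ∑ i, c i ≤ N + t + ∑ i : Fin N, (i : ℕ) →
      0 ≤ (Matrix.of fun i j => complexToeplitz (symmetricMean Φ) (r i) (c j)).det := by
    intro t
    induction t with
    | zero =>
      intro N r c hr hc hrc hN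
      exact det_symmetricMean_nonneg_of_le hΦ h0 hpos hr hc hrc hN
    | succ t ih =>
      intro N r c hr hc hrc hN
      rw [← det_complexToeplitz_cons (symmetricMean_zero h0)]
      refine ih (N + 1) _ _ (strictMono_cons_zero_succ hr) (strictMono_cons_zero_succ hc) ?_ ?_
      · simp only [Fin.sum_univ_succ, Fin.cons_zero, Fin.cons_succ, Finset.sum_add_distrib]
        omega
      · simp only [Fin.sum_univ_succ, Fin.cons_zero, Fin.cons_succ, Finset.sum_add_distrib,
          Fin.val_succ, Fin.val_zero]
        omega
  rcases le_or_gt (∑ i, r i) (∑ i, c i) with h | h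
  · exact key (∑ i, c i) N r c hr hc h (by omega)
  · exact (det_complexToeplitz_eq_zero h).ge

end ToeplitzMinors

/-! ### Characters from totally positive sequences. -/

section FromTotallyPositive

open Equiv MvPolynomial

theorem SymmetricCoeffs.smul {κ : Type*} [Fintype κ] [DecidableEq κ] {P : MvPolynomial κ ℂ}
    (h : SymmetricCoeffs P) (b : ℂ) : SymmetricCoeffs (b • P) := fun σ α => by
  rw [coeffAt_smul, coeffAt_smul, h σ α]

variable {ι : Type*} [Fintype ι] [DecidableEq ι]

theorem toeplitz_det_cast (a : ℕ → ℝ) {N : ℕ} (r c : Fin N → ℕ) :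
    (Matrix.of fun i j => complexToeplitz (fun n => (a n : ℂ)) (r i) (c j)).det =
      ((Matrix.of fun i j => toeplitz a (r i) (c j)).det : ℝ) := by
  have h := Complex.ofRealHom.map_det (Matrix.of fun i j => toeplitz a (r i) (c j))
  rw [Complex.ofRealHom_eq_coe] at h
  rw [h]
  congr 1
  ext i j
  simp only [Matrix.of_apply, RingHom.mapMatrix_apply, Matrix.map_apply, complexToeplitz, toeplitz,
    Complex.ofRealHom_eq_coe]
  split_ifs <;> simp

/-- A totally positive sequence gives positive definite central functions on all finite symmetric
groups. -/
theorem IsTotallyPositive.exists_posDef {a : ℕ → ℝ} (ha : IsTotallyPositive a)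
    (ι : Type*) [Fintype ι] [DecidableEq ι] :
    ∃ ψ : Perm ι → ℂ, IsCentralFun ψ ∧ IsPosDefFun ψ ∧ ∀ w : ι → ι,
      stabSum ψ w = (∏ k, ((wordContent w k).factorial : ℂ)) * ∏ k, (a (wordContent w k) : ℂ) := by
  classical
  set N := Fintype.card ι with hN
  -- The degree `N` part of `∏_i ∑_k a_k x_i^k`. Its Schur coefficients `q c` are the Toeplitz
  -- minors with rows `0, …, N - 1`.
  let A : MvPolynomial (Fin N) ℂ :=
    ∑ α ∈ Finset.piAntidiag Finset.univ N, (∏ i, (a (α i) : ℂ)) • mono α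
  have hA : ∀ α, coeffAt α A = if ∑ i, α i = N then ∏ i, (a (α i) : ℂ) else 0 := by
    intro α
    simp only [A, coeffAt_sum, coeffAt_smul, coeffAt_mono, mul_ite, mul_one, mul_zero,
      Finset.sum_ite_eq', Finset.mem_piAntidiag, Finset.mem_univ, implies_true, and_true]
  have hAsymm : SymmetricCoeffs A := by
    intro σ α
    have h1 : ∑ i, (α ∘ σ) i = ∑ i, α i := Equiv.sum_comp σ α
    have h2 : ∏ i, (a ((α ∘ σ) i) : ℂ) = ∏ i, (a (α i) : ℂ) :=
      Equiv.prod_comp σ fun i => (a (α i) : ℂ)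
    rw [hA, hA, h1, h2]
  let q : (Fin N → ℕ) → ℂ := fun c => coeffAt c (alternant (fun i : Fin N => (i : ℕ)) * A)
  let S : Finset (Fin N → ℕ) :=
    (Finset.piAntidiag Finset.univ (N + ∑ i : Fin N, (i : ℕ))).filter StrictMono
  have hS : ∀ c, c ∈ S ↔ ∑ i, c i = N + ∑ i : Fin N, (i : ℕ) ∧ StrictMono c := by
    intro c
    simp [S, Finset.mem_piAntidiag]
  have hq : ∀ c ∈ S, 0 ≤ q c := by
    intro c hc
    rw [hS] at hc
    have h1 := coeffAt_alternant_mul_eq_det (a := fun n => (a n : ℂ)) (P := A) (n := N) (C := 1)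
      (fun α hα => by rw [hA, if_pos hα, one_mul]) (r := fun i : Fin N => (i : ℕ)) (c := c)
      (by rw [hc.1, add_comm])
    simp only [q]
    rw [h1, one_mul, toeplitz_det_cast]
    exact Complex.zero_le_real.2 (ha N _ _ (fun i j h => h) hc.2)
  have hq0 : ∀ c, StrictMono c → c ∉ S → q c = 0 := by
    intro c hc hcS
    simp only [q]
    rw [coeffAt_alternant_mul]
    refine Finset.sum_eq_zero fun σ _ => ?_
    split_ifs with h
    · rw [hA, if_neg, mul_zero]
      intro h0
      apply hcS
      rw [hS]
      refine ⟨?_, hc⟩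
      have h1 : ∑ i, ((σ i : Fin N) : ℕ) = ∑ i : Fin N, (i : ℕ) :=
        Equiv.sum_comp σ fun i : Fin N => (i : ℕ)
      have h2 : ∑ i, (c - (fun i : Fin N => (i : ℕ)) ∘ σ) i + ∑ i, ((σ i : Fin N) : ℕ) =
          ∑ i, c i := by
        rw [← Finset.sum_add_distrib]
        exact Finset.sum_congr rfl fun i _ => Nat.sub_add_cancel (h i)
      omega
    · rw [mul_zero]
  let ψ : Perm ι → ℂ := fun g => ∑ c ∈ S, q c * schurChar c g
  have hψc : IsCentralFun ψ := fun g h => by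
    simp only [ψ]
    exact Finset.sum_congr rfl fun c _ => by rw [isCentralFun_schurChar c g h]
  have hψp : IsPosDefFun ψ := IsPosDefFun.sum fun c hc =>
    (isPosDefFun_schurChar hN.ge ((hS c).1 hc).2).const_mul (hq c hc)
  -- Both polynomials are symmetric and, by orthogonality, have the same coefficients after
  -- multiplication by the alternant. The coefficients of `A` then give the Young subgroup sums of
  -- `ψ`.
  have hhat : ∑ g, ψ g • fixedWords (Fin N) g - (N.factorial : ℂ) • A = 0 := by
    refine SymmetricCoeffs.eq_zero ((SymmetricCoeffs.sum_smul
      (fun g _ => symmetricCoeffs_fixedWords g) _).sub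
        (hAsymm.smul _)) fun d hd => ?_
    rw [mul_sub, coeffAt_sub, coeffAt_alternant_mul_sum_smul_fixedWords, mul_smul_comm,
      coeffAt_smul]
    change _ - _ * q d = 0
    have h1 : ∑ g, ψ g * schurChar d g = ∑ c ∈ S, if c = d then q c * N.factorial else 0 := by
      simp only [ψ, Finset.sum_mul]
      rw [Finset.sum_comm]
      refine Finset.sum_congr rfl fun c hc => ?_
      simp only [mul_assoc]
      rw [← Finset.mul_sum, sum_schurChar_mul_schurChar ((hS c).1 hc).2 hd ((hS c).1 hc).1,
        mul_ite, mul_zero]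
    rw [h1, Finset.sum_ite_eq']
    split_ifs with h
    · ring
    · rw [hq0 d hd h]; ring
  refine ⟨ψ, hψc, hψp, fun w => ?_⟩
  have e : ι ≃ Fin N := Fintype.equivFin ι
  rw [← stabSum_comp_injective ψ w e e.injective]
  have hcont : ∀ k, wordContent (e ∘ w) (e k) = wordContent w k := by
    intro k
    simp [wordContent]
  have h1 : ∀ F : ℕ → ℂ, ∏ k, F (wordContent w k) = ∏ k, F (wordContent (e ∘ w) k) := by
    intro F
    rw [← Equiv.prod_comp e]
    simp only [hcont]
  rw [h1 fun n => (n.factorial : ℂ), h1 fun n => (a n : ℂ)]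
  have h2 := coeffAt_sum_smul_fixedWords hψc (e ∘ w)
  have h3 : _ = (N.factorial : ℂ) := card_words_mul_prod_factorial (e ∘ w)
  rw [sub_eq_zero.1 hhat, coeffAt_smul, hA, if_pos (sum_wordContent _), ← h3, mul_assoc] at h2
  refine (mul_left_cancel₀ ?_ h2).symm
  refine Nat.cast_ne_zero.2 ?_
  exact Finset.card_ne_zero_of_mem (a := e ∘ w) (by simp)

theorem stabSum_sumMap {ι' : Type*} [Fintype ι'] [DecidableEq ι'] (f : Perm (ι ⊕ ι') → ℂ)
    (w : ι → ι) (v : ι' → ι') :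
    stabSum f (Sum.map w v) =
      stabSum (fun g => stabSum (fun h => f (Perm.sumCongr g h)) v) w := by
  unfold stabSum
  rw [← Finset.sum_product']
  symm
  refine Finset.sum_bij (fun p _ => Perm.sumCongr p.1 p.2) ?_ ?_ ?_ ?_
  · rintro ⟨g, h⟩ hp
    simp only [Finset.mem_product, Finset.mem_filter, Finset.mem_univ, true_and] at hp ⊢
    rintro (i | i)
    · simp [hp.1 i]
    · simp [hp.2 i]
  · rintro p _ p' _ h
    exact Perm.sumCongrHom_injective h
  · intro k hk
    simp only [Finset.mem_filter, Finset.mem_univ, true_and] at hk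
    have hr : k ∈ (Perm.sumCongrHom ι ι').range := by
      refine Perm.mem_sumCongrHom_range_of_perm_mapsTo_inl ?_
      rintro _ ⟨i, rfl⟩
      have := hk (Sum.inl i)
      cases hki : k (Sum.inl i) with
      | inl j => exact ⟨j, rfl⟩
      | inr j => rw [hki] at this; simp at this
    obtain ⟨⟨g, h⟩, rfl⟩ := hr
    refine ⟨(g, h), ?_, rfl⟩
    simp only [Finset.mem_product, Finset.mem_filter, Finset.mem_univ, true_and]
    refine ⟨fun i => ?_, fun i => ?_⟩
    · simpa using hk (Sum.inl i)
    · simpa using hk (Sum.inr i)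
  · intros; rfl

/-- The positive definite central functions given by a totally positive sequence. -/
noncomputable def IsTotallyPositive.posDef {a : ℕ → ℝ} (ha : IsTotallyPositive a)
    (ι : Type*) [Fintype ι] [DecidableEq ι] : Perm ι → ℂ := (ha.exists_posDef ι).choose

theorem IsTotallyPositive.isCentralFun {a : ℕ → ℝ} (ha : IsTotallyPositive a)
    (ι : Type*) [Fintype ι] [DecidableEq ι] : IsCentralFun (ha.posDef ι) :=
  (ha.exists_posDef ι).choose_spec.1

theorem IsTotallyPositive.isPosDefFun {a : ℕ → ℝ} (ha : IsTotallyPositive a)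
    (ι : Type*) [Fintype ι] [DecidableEq ι] : IsPosDefFun (ha.posDef ι) :=
  (ha.exists_posDef ι).choose_spec.2.1

theorem IsTotallyPositive.stabSum_eq {a : ℕ → ℝ} (ha : IsTotallyPositive a) (w : ι → ι) :
    stabSum (ha.posDef ι) w =
      (∏ k, ((wordContent w k).factorial : ℂ)) * ∏ k, (a (wordContent w k) : ℂ) :=
  (ha.exists_posDef ι).choose_spec.2.2 w

/-- Both sides are central in each variable and have the same sums over products of Young subgroups,
because these sums are products over letters. Uniqueness is applied in `g`, then in `h`. -/
theorem IsTotallyPositive.posDef_sumCongr {a : ℕ → ℝ} (ha : IsTotallyPositive a)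
    {ι' : Type*} [Fintype ι'] [DecidableEq ι'] (g : Perm ι) (h : Perm ι') :
    ha.posDef (ι ⊕ ι') (Perm.sumCongr g h) = ha.posDef ι g * ha.posDef ι' h := by
  have hsplit : ∀ (w : ι → ι) (v : ι' → ι'), stabSum (ha.posDef (ι ⊕ ι')) (Sum.map w v) =
      stabSum (ha.posDef ι) w * stabSum (ha.posDef ι') v := by
    intro w v
    rw [ha.stabSum_eq, ha.stabSum_eq, ha.stabSum_eq, Fintype.prod_sum_type, Fintype.prod_sum_type]
    have e1 : ∀ k, wordContent (Sum.map w v) (Sum.inl k) = wordContent w k := by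
      intro k
      simp only [wordContent_eq_card, Finset.card_filter, Fintype.sum_sum_type, Sum.map_inl,
        Sum.map_inr, Sum.inl.injEq, reduceCtorEq, if_false, Finset.sum_const_zero, add_zero]
    have e2 : ∀ k, wordContent (Sum.map w v) (Sum.inr k) = wordContent v k := by
      intro k
      simp only [wordContent_eq_card, Finset.card_filter, Fintype.sum_sum_type, Sum.map_inl,
        Sum.map_inr, Sum.inr.injEq, reduceCtorEq, if_false, Finset.sum_const_zero, zero_add]
    simp only [e1, e2]
    ring
  have h1 : ∀ v : ι' → ι', (fun g : Perm ι => stabSum (fun h : Perm ι' =>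
      ha.posDef (ι ⊕ ι') (Perm.sumCongr g h)) v - ha.posDef ι g * stabSum (ha.posDef ι') v) = 0 := by
    intro v
    refine IsCentralFun.eq_zero_of_stabSum (isCentralFun_of_conj fun g k => ?_) fun w => ?_
    · rw [(ha.isCentralFun ι).conj]
      congr 1
      unfold stabSum
      refine Finset.sum_congr rfl fun h _ => ?_
      have := (ha.isCentralFun (ι ⊕ ι')).conj (Perm.sumCongr g h) (Perm.sumCongr k 1)
      beta_reduce
      rw [← this, Perm.sumCongr_inv, Perm.sumCongr_mul, Perm.sumCongr_mul]
      simp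
    · have h2 := hsplit w v
      rw [stabSum_sumMap] at h2
      unfold stabSum at h2 ⊢
      rw [Finset.sum_sub_distrib, h2, Finset.sum_mul, sub_self]
  have h2 : (fun h : Perm ι' => ha.posDef (ι ⊕ ι') (Perm.sumCongr g h) -
      ha.posDef ι g * ha.posDef ι' h) = 0 := by
    refine IsCentralFun.eq_zero_of_stabSum (isCentralFun_of_conj fun h k => ?_) fun v => ?_
    · rw [(ha.isCentralFun ι').conj]
      congr 1
      have := (ha.isCentralFun (ι ⊕ ι')).conj (Perm.sumCongr g h) (Perm.sumCongr 1 k)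
      rw [← this, Perm.sumCongr_inv, Perm.sumCongr_mul, Perm.sumCongr_mul]
      simp
    · have h3 := congrFun (h1 v) g
      unfold stabSum at h3 ⊢
      rw [Finset.sum_sub_distrib, ← Finset.mul_sum]
      exact h3
  exact sub_eq_zero.1 (congrFun h2 h)

theorem IsTotallyPositive.posDef_one {a : ℕ → ℝ} (ha : IsTotallyPositive a) (h1 : a 1 = 1)
    (ι : Type*) [Fintype ι] [DecidableEq ι] : ha.posDef ι 1 = 1 := by
  have h := ha.stabSum_eq (ι := ι) id
  have hc : ∀ k : ι, wordContent (id : ι → ι) k = 1 := by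
    intro k
    simp [wordContent_eq_card, Finset.filter_eq']
  have hs : (Finset.univ.filter fun g : Perm ι => ∀ i, id (g i) = id i) = {1} := by
    ext g
    simp [Equiv.ext_iff]
  simp only [hc, h1] at h
  rw [stabSum, hs] at h
  simpa using h

/-- Padding by the identity changes nothing, since `a 1 = 1` makes the value at the identity `1`;
after padding to `ι ⊕ ι'` the two permutations are conjugate. This also makes the functions for
different `n` compatible. -/
theorem IsTotallyPositive.posDef_eq_of_cycleType_eq {a : ℕ → ℝ} (ha : IsTotallyPositive a)
    (h1 : a 1 = 1) {ι' : Type*} [Fintype ι'] [DecidableEq ι'] {g : Perm ι} {h : Perm ι'}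
    (e : g.cycleType = h.cycleType) : ha.posDef ι g = ha.posDef ι' h := by
  have e1 := ha.posDef_sumCongr g (1 : Perm ι')
  have e2 := ha.posDef_sumCongr (1 : Perm ι) h
  rw [ha.posDef_one h1, mul_one] at e1
  rw [ha.posDef_one h1, one_mul] at e2
  rw [← e1, ← e2]
  refine (ha.isCentralFun (ι ⊕ ι')).eq_of_isConj (Perm.isConj_iff_cycleType_eq.2 ?_)
  rw [cycleType_sumCongr, cycleType_sumCongr, e, Perm.cycleType_one, Perm.cycleType_one, add_comm]

theorem IsNormalizedTotallyPositive.exists_character {a : ℕ → ℝ}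
    (ha : IsNormalizedTotallyPositive a) :
    ∃ φ : SInf → ℂ, IsGroupCharacter φ ∧ oneRowCoeff φ = fun n => (a n : ℂ) := by
  classical
  obtain ⟨hp, ha0, ha1⟩ := ha
  let Φ : Multiset ℕ → ℂ := fun s =>
    if h : ∃ (n : ℕ) (g : Perm (Fin n)), g.cycleType = s then
      hp.posDef _ h.choose_spec.choose else 0
  have hΦ : ∀ (n : ℕ) (g : Perm (Fin n)), Φ g.cycleType = hp.posDef (Fin n) g := by
    intro n g
    have h : ∃ (m : ℕ) (k : Perm (Fin m)), k.cycleType = g.cycleType := ⟨n, g, rfl⟩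
    simp only [Φ, dif_pos h]
    exact hp.posDef_eq_of_cycleType_eq ha1 h.choose_spec.choose_spec
  have hΦ0 : Φ 0 = 1 := by
    rw [← Perm.cycleType_one (α := Fin 0), hΦ, hp.posDef_one ha1]
  have hmul : IsMultiplicativeOnCycleTypes Φ := by
    intro m n g h
    have e : g.cycleType + h.cycleType =
        (finSumFinEquiv.permCongr (Perm.sumCongr g h)).cycleType := by
      rw [cycleType_permCongr, cycleType_sumCongr]
    rw [hΦ, hΦ, e, hΦ, ← hp.posDef_sumCongr]
    exact hp.posDef_eq_of_cycleType_eq ha1 (cycleType_permCongr _ _)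
  have hpos : IsPosDefFun fun x : SInf => Φ (SInf.cycleType x) :=
    isPosDefFun_cycleType fun n => by
      rw [show (fun g : Perm (Fin n) => Φ g.cycleType) = hp.posDef (Fin n) from funext (hΦ n)]
      exact hp.isPosDefFun (Fin n)
  refine ⟨_, hmul.isGroupCharacter hΦ0 hpos, ?_⟩
  funext n
  rw [oneRowCoeff_cycleType]
  rcases Nat.eq_zero_or_pos n with rfl | hn
  · rw [symmetricMean_zero hΦ0, ha0, Complex.ofReal_one]
  · rw [symmetricMean]
    simp only [hΦ]
    -- The Young subgroup of a constant word is the whole group. The unused letters contribute `a 0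
    -- = 1`; the empty alphabet for `n = 0` is treated apart.
    have hw := hp.stabSum_eq (fun _ : Fin n => (⟨0, hn⟩ : Fin n))
    have hc : ∀ k : Fin n, wordContent (fun _ : Fin n => (⟨0, hn⟩ : Fin n)) k =
        if k = ⟨0, hn⟩ then n else 0 := by
      intro k
      rw [wordContent_eq_card]
      by_cases hk : k = ⟨0, hn⟩
      · simp [hk]
      · simp [hk, Ne.symm hk]
    have hF : ∀ F : ℕ → ℂ, F 0 = 1 →
        ∏ k : Fin n, F (if k = ⟨0, hn⟩ then n else 0) = F n := by
      intro F hF0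
      rw [Finset.prod_eq_single (⟨0, hn⟩ : Fin n)]
      · simp
      · intro k _ hk
        rw [if_neg hk, hF0]
      · simp
    simp only [hc] at hw
    rw [hF (fun n => (n.factorial : ℂ)) (by simp), hF (fun n => (a n : ℂ)) (by simp [ha0])] at hw
    have hs : stabSum (hp.posDef (Fin n)) (fun _ : Fin n => (⟨0, hn⟩ : Fin n)) =
        ∑ g, hp.posDef (Fin n) g := by
      simp [stabSum]
    rw [← hs, hw, inv_mul_cancel_left₀ (by exact_mod_cast Nat.factorial_ne_zero n)]

end FromTotallyPositive

/-! ### The bijection. -/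

theorem IsGroupCharacter.exists_normalizedTotallyPositive {φ : SInf → ℂ}
    (hφ : IsGroupCharacter φ) :
    ∃ a : ℕ → ℝ, IsNormalizedTotallyPositive a ∧ (fun n => (a n : ℂ)) = oneRowCoeff φ := by
  obtain ⟨Φ, rfl⟩ := hφ.central.exists_eq_cycleType
  have hmul := hφ.isMultiplicativeOnCycleTypes
  have h0 : Φ 0 = 1 := by
    have := hφ.normalized
    rwa [SInf.cycleType_one] at this
  have hdet := fun {N : ℕ} {r c : Fin N → ℕ} (hr : StrictMono r) (hc : StrictMono c) =>
    det_symmetricMean_nonneg hmul h0 hφ.posDef hr hc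
  have hreal : (fun n => ((symmetricMean Φ n).re : ℂ)) = symmetricMean Φ := by
    funext n
    -- The minor of size one in row `0` and column `n` is the coefficient itself, so its
    -- nonnegativity in `ℂ` includes that it is real.
    have h := hdet (r := fun _ : Fin 1 => 0) (c := fun _ => n) (Subsingleton.strictMono _)
      (Subsingleton.strictMono _)
    simp only [Matrix.det_unique, Matrix.of_apply, complexToeplitz, Nat.zero_le, if_true,
      Nat.sub_zero] at h
    exact Complex.ext (by simp) (by simpa using (Complex.nonneg_iff.1 h).2)
  refine ⟨fun n => (symmetricMean Φ n).re, ⟨fun k r c hr hc => ?_, ?_, ?_⟩, ?_⟩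
  · have h := hdet hr hc
    rw [← hreal, toeplitz_det_cast] at h
    exact Complex.zero_le_real.1 h
  · simp [symmetricMean_zero h0]
  · have : ∀ g : Equiv.Perm (Fin 1), g = 1 := fun g => Subsingleton.elim _ _
    simp [symmetricMean, h0]
  · rw [hreal]
    funext n
    exact (oneRowCoeff_cycleType Φ n).symm

/-- By multiplicativity the one-row coefficients give all Young subgroup sums, and these determine a
central function on each `S(n)`. -/
theorem IsGroupCharacter.eq_of_oneRowCoeff_eq {φ₁ φ₂ : SInf → ℂ} (h₁ : IsGroupCharacter φ₁)
    (h₂ : IsGroupCharacter φ₂) (h : oneRowCoeff φ₁ = oneRowCoeff φ₂) : φ₁ = φ₂ := by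
  obtain ⟨Φ₁, rfl⟩ := h₁.central.exists_eq_cycleType
  obtain ⟨Φ₂, rfl⟩ := h₂.central.exists_eq_cycleType
  have e₁ : Φ₁ 0 = 1 := by
    have := h₁.normalized
    rwa [SInf.cycleType_one] at this
  have e₂ : Φ₂ 0 = 1 := by
    have := h₂.normalized
    rwa [SInf.cycleType_one] at this
  have hm : symmetricMean Φ₁ = symmetricMean Φ₂ := by
    funext n
    rw [← oneRowCoeff_cycleType, ← oneRowCoeff_cycleType, h]
  funext x
  obtain ⟨n, g, hg⟩ := SInf.exists_incl_eq_finite fun _ : Unit => x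
  rw [← hg (), SInf.cycleType_incl]
  have hd : (fun g : Equiv.Perm (Fin n) => Φ₁ g.cycleType - Φ₂ g.cycleType) = 0 := by
    refine IsCentralFun.eq_zero_of_stabSum
      (isCentralFun_cycleType_perm fun s => Φ₁ s - Φ₂ s) fun w => ?_
    have s₁ := h₁.isMultiplicativeOnCycleTypes.stabSum_eq e₁ w
    have s₂ := h₂.isMultiplicativeOnCycleTypes.stabSum_eq e₂ w
    rw [hm, ← s₂] at s₁
    unfold stabSum at s₁ ⊢
    rw [Finset.sum_sub_distrib, s₁, sub_self]
  exact sub_eq_zero.1 (congrFun hd (g ()))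

/-- Real sequences are regarded as complex ones through the inclusion of the reals in the complex
numbers; in particular the statement says that the coefficients of a character are real. -/
theorem proposition5 :
    Set.BijOn oneRowCoeff {φ : SInf → ℂ | IsGroupCharacter φ}
      ((fun (a : ℕ → ℝ) (n : ℕ) => (a n : ℂ)) '' {a : ℕ → ℝ | IsNormalizedTotallyPositive a}) := by
  refine ⟨fun φ hφ => ?_, fun φ₁ h₁ φ₂ h₂ h => ?_, ?_⟩
  · obtain ⟨a, ha, h⟩ := IsGroupCharacter.exists_normalizedTotallyPositive hφ
    exact ⟨a, ha, h⟩
  · exact IsGroupCharacter.eq_of_oneRowCoeff_eq h₁ h₂ h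
  · rintro _ ⟨a, ha, rfl⟩
    obtain ⟨φ, hφ, h⟩ := IsNormalizedTotallyPositive.exists_character ha
    exact ⟨φ, hφ, h⟩
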